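/- **Setting.** Fix integers $m,n\ge 0$ and real $m\times m$ matrices $\hat R_j$ with $\hat R_{-j}=\hat R_j^T$, $|j|\le n$, such that the block Toeplitz matrix $[\hat R_{k-h}]_{h,k=0}^n$ is positive definite. Put $\hat\Phi_m(e^{i\vartheta})=\sum_{j=-n}^n e^{-ij\vartheta}\hat R_j$, and let $\int$ denote integration over the unit circle with respect to normalized Lebesgue measure. Let $\mathcal Q_{m,n}$ be the set of functions $\sum_{j=-n}^n e^{-ij\vartheta}R_j$ with $R_j=R_{-j}^T\in\mathbb R^{m\times m}$. Write $F\succ0$ (resp. $F\succeq 0$) if $F(e^{i\vartheta})$ is positive definite (resp. semidefinite) for every $\vartheta$, put $\Delta(e^{i\vartheta})=[I_m\; e^{i\vartheta}I_m\;\cdots\; e^{in\vartheta}I_m]$ and $\langle A,B\rangle=\operatorname{tr}(AB^*)$, and let $$J(F)=\int\big(-\log\det F+\langle F,\hat\Phi_m\rangle\big).$$ *Regularized problem*, with parameters $\lambda,\gamma>0$: minimize $$J(\Sigma-\Lambda)+\lambda\big(\gamma\,\phi_1(\Sigma)+\phi_*(\Lambda)\big)\quad\text{over }\Sigma,\Lambda\in\mathcal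 Q_{m,n},\ \Sigma-\Lambda\succ0,\ \Lambda\succeq0 .$$ Here $\phi_*(\Lambda)=\sum_{k=1}^m\int\sigma_k(\Lambda)$ with $\sigma_k$ the singular values, and for $\Sigma=\sum_j e^{-ij\vartheta}S_j$, $Y_0=S_0$, $Y_j=2S_j$ ($1\le j\le n$), $$\phi_1(\Sigma)=\sum_{k>h}\ \max_{0\le j\le n}\max\{|(Y_j)_{kh}|,|(Y_j)_{hk}|\}.$$ *Estimated subspaces.* We say that $(E_m,G)$ is estimated from the regularized problem if there is a solution $(\tilde\Sigma,\tilde\Lambda)$ of it such that $E_m=\{(k,h):\tilde\Sigma_{kh}\not\equiv0\}$ and $\tilde\Lambda=\Delta G^TG\Delta^*$ with $G\in\mathbb R^{l\times m(n+1)}$ of full row rank $l$ (for some $l\geq 0$). Then put $$\mathcal V_{E_m}=\{\Sigma\in\mathcal Q_{m,n}:\ \Sigma_{kh}\equiv0\ \ \forall (k,h)\notin E_m\},\qquad \mathcal V_G=\{\Delta G^THG\Delta^*:\ H=H^T\in\mathbb R^{l\times l}\}.$$ *Identification problem* for given $(E_m,G)$: minimize $J(\Sigma-\Lambda)$ over $\Sigma,\Lambda\in\mathcal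 Q_{m,n}$ subject to $\Sigma-\Lambda\succ0$, $\Lambda\succeq0$, $\Sigma\in\mathcal V_{E_m}$, $\Lambda\in\mathcal V_G$. We say that the model for $(E_m,G)$ is *unique* if the identification problem has exactly one solution $(\Sigma^\circ,\Lambda^\circ)$, and $(\Sigma^\circ,\Lambda^\circ)$ is the only pair $(\Sigma,\Lambda)\in\mathcal V_{E_m}\times\mathcal V_G$ with $\Sigma-\Lambda=\Sigma^\circ-\Lambda^\circ$, i.e. the decomposition of the optimal inverse spectral density is unique. **Corollary.** 1. There are constants $c_1,c_2$, depending only on $m$, $n$ and $\hat R$, such that for all $\lambda,\gamma>0$ with $\lambda\gamma\ge c_1$ and $\lambda\ge c_2$, and for every $(E_m,G)$ estimated from the regularized problem with parameters $\lambda,\gamma$: $\mathcal V_{E_m}\cap\mathcal V_G=\{0\}$ and the model for $(E_m,G)$ is unique. 2. Moreover, for arbitrary $\lambda,\gamma>0$ and every $(E_m,G)$ estimated from the regularized problem with parameters $\lambda,\gamma$: if $\mathcal V_{E_m}\cap\mathcal V_G=\{0\}$, then the model for $(E_m,G)$ is unique. -/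

import Mathlib

open scoped ComplexOrder Matrix

noncomputable section

namespace ARLatent

/-- Matrix valued functions on the unit circle, as functions of the angle `θ`. -/
abbrev CircleFn (m : ℕ) : Type := ℝ → Matrix (Fin m) (Fin m) ℂ

/-- Integral of a real valued function against the normalized Lebesgue measure on the circle. -/
def mean (f : ℝ → ℝ) : ℝ :=
  (2 * Real.pi)⁻¹ * ∫ θ in (-Real.pi)..Real.pi, f θ

/-- Integral of a complex valued function against the normalized Lebesgue measure on the circle. -/
def cmean (f : ℝ → ℂ) : ℂ :=
  ((2 * Real.pi)⁻¹ : ℝ) • ∫ θ in (-Real.pi)..Real.pi, f θ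

/-- A two-sided sequence of real matrices with `R_{-j} = R_jᵀ`.  Only the entries with `|j| ≤ n`
are used below, so such a sequence stands for an element `[R_0 R_1 … R_n]` of `M_{m,n}`. -/
def IsLagSequence {m : ℕ} (R : ℤ → Matrix (Fin m) (Fin m) ℝ) : Prop :=
  ∀ j, R (-j) = (R j)ᵀ

/-- The pseudo-polynomial `∑_{j=-n}^{n} e^{-ijθ} R_j`. -/
def symbol {m : ℕ} (n : ℕ) (R : ℤ → Matrix (Fin m) (Fin m) ℝ) : CircleFn m := fun θ =>
  ∑ j ∈ Finset.Icc (-(n : ℤ)) (n : ℤ),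
    Complex.exp (-(Complex.I * (j : ℂ) * (θ : ℂ))) • (R j).map Complex.ofReal

/-- The family `Q_{m,n}` of matrix pseudo-polynomials of order `n`. -/
def pseudoPoly (m n : ℕ) : Set (CircleFn m) :=
  {F | ∃ R : ℤ → Matrix (Fin m) (Fin m) ℝ, IsLagSequence R ∧ F = symbol n R}

/-- The symmetric block Toeplitz matrix whose first block row is `[R_0 R_1 … R_n]`. -/
def blockToeplitz {m : ℕ} (n : ℕ) (R : ℤ → Matrix (Fin m) (Fin m) ℝ) :
    Matrix (Fin (n + 1) × Fin m) (Fin (n + 1) × Fin m) ℝ :=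
  Matrix.of fun p q => R (((q.1 : ℕ) : ℤ) - ((p.1 : ℕ) : ℤ)) p.2 q.2

/-- The shift operator `Δ(e^{iθ}) = [I  e^{iθ} I  …  e^{inθ} I]`. -/
def shift (m n : ℕ) (θ : ℝ) : Matrix (Fin m) (Fin (n + 1) × Fin m) ℂ :=
  Matrix.of fun a q =>
    if a = q.2 then Complex.exp (Complex.I * (((q.1 : ℕ) : ℂ)) * (θ : ℂ)) else 0

/-- The function `Δ X Δ*`. -/
def shiftQuad {m n : ℕ} (X : Matrix (Fin (n + 1) × Fin m) (Fin (n + 1) × Fin m) ℝ) :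
    CircleFn m := fun θ =>
  shift m n θ * X.map Complex.ofReal * (shift m n θ)ᴴ

/-- `F ≻ 0` on the circle. -/
def PosDefOn {m : ℕ} (F : CircleFn m) : Prop := ∀ θ, (F θ).PosDef

/-- `F ⪰ 0` on the circle. -/
def PosSemidefOn {m : ℕ} (F : CircleFn m) : Prop := ∀ θ, (F θ).PosSemidef

/-- `∫ (-log det F + ⟨F, Φ̂⟩)` with `⟨A, B⟩ = tr (A B*)`.  For `F ≻ 0` and Hermitian `Φ̂` both
the determinant and the trace are real numbers. -/
def entropyCost {m : ℕ} (PhiHat F : CircleFn m) : ℝ :=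
  mean fun θ => -Real.log (F θ).det.re + (F θ * (PhiHat θ)ᴴ).trace.re

/-- The coefficient `S_j` of `e^{-ijθ}` in `F`. -/
def lagCoeff {m : ℕ} (F : CircleFn m) (j : ℤ) : Matrix (Fin m) (Fin m) ℂ :=
  Matrix.of fun k h => cmean fun θ => Complex.exp (Complex.I * (j : ℂ) * (θ : ℂ)) * F θ k h

/-- The one-sided coefficients `Y_0 = S_0` and `Y_j = 2 S_j` for `j ≥ 1`; for `F = Δ X Δ*` these
are `D_0(X) = ∑_h X_{hh}` and `D_j(X) = 2 ∑_h X_{h,h+j}`. -/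
def oneSided {m : ℕ} (F : CircleFn m) (j : ℕ) : Matrix (Fin m) (Fin m) ℂ :=
  (if j = 0 then (1 : ℂ) else 2) • lagCoeff F j

/-- The sparsity regularizer: the sum over `k > h` of
`max_{0 ≤ j ≤ n} max (|(Y_j)_{kh}|, |(Y_j)_{hk}|)`. -/
def sparsityPenalty {m : ℕ} (n : ℕ) (F : CircleFn m) : ℝ :=
  ∑ k : Fin m, ∑ h : Fin m, if h < k then
    ⨆ j : Fin (n + 1), max ‖oneSided F (j : ℕ) k h‖ ‖oneSided F (j : ℕ) h k‖
  else 0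

/-- The sum of the singular values of `A` (the square roots of the eigenvalues of `A* A`). -/
def sumSingularValues {m : ℕ} (A : Matrix (Fin m) (Fin m) ℂ) : ℝ :=
  ∑ k, Real.sqrt ((Matrix.isHermitian_conjTranspose_mul_self A).eigenvalues k)

/-- The low-rank regularizer `∑_k ∫ σ_k(F)`. -/
def lowRankPenalty {m : ℕ} (F : CircleFn m) : ℝ :=
  mean fun θ => sumSingularValues (F θ)

/-- Feasible pairs `(Σ, Λ)` of the regularized problem. -/
def regFeasible (m n : ℕ) : Set (CircleFn m × CircleFn m) :=
  {p | p.1 ∈ pseudoPoly m n ∧ p.2 ∈ pseudoPoly m n ∧ PosDefOn (p.1 - p.2) ∧ PosSemidefOn p.2}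

/-- Objective of the regularized problem. -/
def regCost {m : ℕ} (n : ℕ) (R : ℤ → Matrix (Fin m) (Fin m) ℝ) (lam gam : ℝ)
    (p : CircleFn m × CircleFn m) : ℝ :=
  entropyCost (symbol n R) (p.1 - p.2)
    + lam * (gam * sparsityPenalty n p.1 + lowRankPenalty p.2)

/-- `(Σ, Λ)` solves the regularized problem. -/
def IsRegSolution {m : ℕ} (n : ℕ) (R : ℤ → Matrix (Fin m) (Fin m) ℝ) (lam gam : ℝ)
    (p : CircleFn m × CircleFn m) : Prop :=
  p ∈ regFeasible m n ∧ IsMinOn (regCost n R lam gam) (regFeasible m n) p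

/-- The support of a matrix function: the positions whose entry is not identically zero. -/
def supp {m : ℕ} (F : CircleFn m) : Set (Fin m × Fin m) :=
  {kh | ∃ θ, F θ kh.1 kh.2 ≠ 0}

/-- The subspace `V_E` of pseudo-polynomials supported in `E`. -/
def sparseSpace {m : ℕ} (n : ℕ) (E : Set (Fin m × Fin m)) : Set (CircleFn m) :=
  {F | F ∈ pseudoPoly m n ∧ ∀ k h, (k, h) ∉ E → ∀ θ, F θ k h = 0}

/-- The subspace `V_G = {Δ Gᵀ H G Δ* : H symmetric}`. -/
def lowRankSpace {m n l : ℕ} (G : Matrix (Fin l) (Fin (n + 1) × Fin m) ℝ) : Set (CircleFn m) :=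
  {F | ∃ H : Matrix (Fin l) (Fin l) ℝ, H.IsSymm ∧ F = shiftQuad (Gᵀ * H * G)}

/-- `E` and `G` describe subspaces `V_E` and `V_G` estimated from the regularized problem: for some
solution `(Σ, Λ)`, `E` is the support of `Σ`, and `Λ = Δ Gᵀ G Δ*` with `G` of full row rank. -/
def IsEstimate {m n l : ℕ} (R : ℤ → Matrix (Fin m) (Fin m) ℝ) (lam gam : ℝ)
    (E : Set (Fin m × Fin m)) (G : Matrix (Fin l) (Fin (n + 1) × Fin m) ℝ) : Prop :=
  ∃ S L : CircleFn m, IsRegSolution n R lam gam (S, L) ∧ E = supp S ∧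
    G.rank = l ∧ L = shiftQuad (Gᵀ * G)

/-- Feasible pairs `(Σ, Λ)` of the identification problem with fixed subspaces. -/
def arFeasible {m n l : ℕ} (E : Set (Fin m × Fin m))
    (G : Matrix (Fin l) (Fin (n + 1) × Fin m) ℝ) : Set (CircleFn m × CircleFn m) :=
  {p | p.1 ∈ pseudoPoly m n ∧ p.2 ∈ pseudoPoly m n ∧ PosDefOn (p.1 - p.2) ∧ PosSemidefOn p.2 ∧
    p.1 ∈ sparseSpace n E ∧ p.2 ∈ lowRankSpace G}

/-- `(Σ, Λ)` solves the identification problem with fixed subspaces. -/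
def IsARSolution {m n l : ℕ} (R : ℤ → Matrix (Fin m) (Fin m) ℝ) (E : Set (Fin m × Fin m))
    (G : Matrix (Fin l) (Fin (n + 1) × Fin m) ℝ) (p : CircleFn m × CircleFn m) : Prop :=
  p ∈ arFeasible E G ∧
    IsMinOn (fun q : CircleFn m × CircleFn m => entropyCost (symbol n R) (q.1 - q.2))
      (arFeasible E G) p

/-- The identification problem has exactly one solution `(Σ°, Λ°)`, and the optimal inverse spectral
density `Σ° - Λ°` has no other decomposition into elements of `V_E` and `V_G`. -/
def HasUniqueModel {m n l : ℕ} (R : ℤ → Matrix (Fin m) (Fin m) ℝ) (E : Set (Fin m × Fin m))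
    (G : Matrix (Fin l) (Fin (n + 1) × Fin m) ℝ) : Prop :=
  ∃ S L : CircleFn m, IsARSolution R E G (S, L) ∧
    (∀ S' L' : CircleFn m, IsARSolution R E G (S', L') → S' = S ∧ L' = L) ∧
    (∀ S' L' : CircleFn m, S' ∈ sparseSpace n E → L' ∈ lowRankSpace G →
      S' - L' = S - L → S' = S ∧ L' = L)

end ARLatent

end

/-! The second claim is strict convexity plus coercivity. If $\mathcal V_E\cap\mathcal V_G=\{0\}$,
the map $(\Sigma,\Lambda)\mapsto\Sigma-\Lambda$ is injective on $\mathcal V_E\times\mathcal V_G$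
(`decomposition_unique`), so it suffices that $J$ has exactly one minimizer among the feasible
differences. Uniqueness follows from strict concavity of $\log\det$ at midpoints
(`symbol_eq_of_entropyCost_le_midpoint`).

Existence needs control at both ends. At infinity, positive definiteness of the block Toeplitz
matrix gives $\int\langle F,\hat\Phi_m\rangle\ge\varepsilon\operatorname{tr}F_0$ for all $F\succeq0$
(`exists_pos_mul_trace_le_lagPairing`). Here $\hat\Phi_m$ itself need not be positive, so the $\hat
R_j$ are first realized as correlations of the orbit of an isometry. Near singular $F$, adding $tI$
lowers $J$ for a suitable uniform $t$ (`exists_entropyCost_add_lt`): a nonnegative trigonometric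
polynomial of size below $t$ at a point stays of order $t$ on an interval of length $\sqrt t$, so
$\int\log\det$ gains order $\sqrt t$ against a linear cost of order $t$. Minimization thus reduces
to a compact set (`exists_entropyCost_minimizer`). The direction $I$ is available in $\mathcal V_E$
because $\tilde\Sigma\succ0$ puts the diagonal in $E$.

For the first claim, compare $(\tilde\Sigma,\tilde\Lambda)$ with
$(\operatorname{diag}\tilde\Sigma,0)$. By Hadamard's inequality the $\log\det$ term does not get
worse, and the linear term changes by at most $\sum|\hat R_j|$ times
$\phi_1(\tilde\Sigma)+\phi_*(\tilde\Lambda)$ (`entropyCost_diagLag_le`). For large $\lambda\gamma$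
and $\lambda$ optimality forces $\tilde\Lambda=0$, hence $G=0$ and $\mathcal V_G=\{0\}$, and the
second claim applies. -/

namespace ARLatent

/-! ### Determinant, trace and eigenvalue inequalities for positive definite matrices -/

section MatrixFacts

variable {ι : Type*} [Fintype ι] [DecidableEq ι]

open scoped MatrixOrder in
theorem exists_eq_conjTranspose_mul_self {𝕜 : Type*} [RCLike 𝕜] {A : Matrix ι ι 𝕜}
    (hA : A.PosSemidef) : ∃ S : Matrix ι ι 𝕜, A = Sᴴ * S :=
  CStarAlgebra.nonneg_iff_eq_star_mul_self.mp hA.nonneg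

theorem PosDef.det_re_pos {A : Matrix ι ι ℂ} (hA : A.PosDef) : 0 < A.det.re :=
  (Complex.pos_iff.mp hA.det_pos).1

theorem PosDef.det_eq_re {A : Matrix ι ι ℂ} (hA : A.PosDef) : A.det = (A.det.re : ℂ) :=
  Complex.ext rfl (by simp [← (Complex.pos_iff.mp hA.det_pos).2])

theorem log_det_re_eq_sum {A : Matrix ι ι ℂ} (hA : A.PosDef) :
    Real.log A.det.re = ∑ i, Real.log (hA.1.eigenvalues i) := by
  rw [← Real.log_prod fun i _ => (hA.eigenvalues_pos i).ne', hA.1.det_eq_prod_eigenvalues]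
  norm_cast

theorem trace_re_eq_sum {A : Matrix ι ι ℂ} (hA : A.IsHermitian) :
    A.trace.re = ∑ i, hA.eigenvalues i := by
  rw [hA.trace_eq_sum_eigenvalues]
  simp

theorem log_det_re_le_trace_sub_card {A : Matrix ι ι ℂ} (hA : A.PosDef) :
    Real.log A.det.re ≤ A.trace.re - Fintype.card ι := by
  rw [log_det_re_eq_sum hA, trace_re_eq_sum hA.1]
  have h : ∑ i, hA.1.eigenvalues i - (Fintype.card ι : ℝ) = ∑ i, (hA.1.eigenvalues i - 1) := by
    simp [Finset.sum_sub_distrib]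
  rw [h]
  exact Finset.sum_le_sum fun i _ => Real.log_le_sub_one_of_pos (hA.eigenvalues_pos i)

theorem eq_one_of_log_det_re_eq {A : Matrix ι ι ℂ} (hA : A.PosDef)
    (h : A.trace.re - Fintype.card ι ≤ Real.log A.det.re) : A = 1 := by
  rw [log_det_re_eq_sum hA, trace_re_eq_sum hA.1] at h
  have h' : ∑ i, hA.1.eigenvalues i - (Fintype.card ι : ℝ) = ∑ i, (hA.1.eigenvalues i - 1) := by
    simp [Finset.sum_sub_distrib]
  rw [h'] at h
  have hle : ∀ i ∈ Finset.univ, Real.log (hA.1.eigenvalues i) ≤ hA.1.eigenvalues i - 1 :=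
    fun i _ => Real.log_le_sub_one_of_pos (hA.eigenvalues_pos i)
  have heq := (Finset.sum_eq_sum_iff_of_le hle).mp (le_antisymm (Finset.sum_le_sum hle) h)
  have h1 : ∀ i, hA.1.eigenvalues i = 1 := by
    intro i
    by_contra hne
    exact (Real.log_lt_sub_one_of_pos (hA.eigenvalues_pos i) hne).ne (heq i (Finset.mem_univ i))
  rw [hA.1.spectral_theorem]
  have : (RCLike.ofReal ∘ hA.1.eigenvalues : ι → ℂ) = fun _ => 1 := by
    funext i; simp [h1 i]
  rw [this, Matrix.diagonal_one, map_one]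

/-- The logarithm of the determinant lies below its tangent at `B`. -/
theorem log_det_re_le {A B : Matrix ι ι ℂ} (hA : A.PosDef) (hB : B.PosDef) :
    Real.log A.det.re ≤ Real.log B.det.re + (B⁻¹ * A).trace.re - Fintype.card ι ∧
      (Real.log B.det.re + (B⁻¹ * A).trace.re - Fintype.card ι ≤ Real.log A.det.re → A = B) := by
  -- Congruence by a factor $S$ of $B^{-1}=S^*S$ moves the tangent point to $I$: everything reduces
  -- to $\log\det X\le\operatorname{tr}X-\operatorname{card}\iota$ and its equality case for
  -- $X=SAS^*$.
  obtain ⟨S, hS⟩ := exists_eq_conjTranspose_mul_self hB.inv.posSemidef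
  have hBu : IsUnit B.det := (Matrix.isUnit_iff_isUnit_det B).mp hB.isUnit
  have hSu : IsUnit S := by
    have h : IsUnit (Sᴴ * S).det := by
      rw [← hS]; exact (Matrix.isUnit_iff_isUnit_det _).mp hB.inv.isUnit
    rw [Matrix.det_mul] at h
    exact (Matrix.isUnit_iff_isUnit_det S).mpr (isUnit_of_mul_isUnit_right h)
  have hX : (S * A * Sᴴ).PosDef := by
    have := (Matrix.IsUnit.posDef_star_right_conjugate_iff (x := A) hSu).mpr hA
    simpa [Matrix.star_eq_conjTranspose] using this
  have htr : (S * A * Sᴴ).trace = (B⁻¹ * A).trace := by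
    rw [hS, Matrix.trace_mul_comm, ← Matrix.mul_assoc]
  have hdet : (S * A * Sᴴ).det.re * B.det.re = A.det.re := by
    have h : (S * A * Sᴴ).det * B.det = A.det := by
      have h2 : (Sᴴ * S).det * B.det = 1 := by
        rw [← hS, ← Matrix.det_mul, Matrix.nonsing_inv_mul B hBu, Matrix.det_one]
      rw [Matrix.det_mul] at h2
      rw [Matrix.det_mul, Matrix.det_mul]
      linear_combination A.det * h2
    rw [PosDef.det_eq_re hX, PosDef.det_eq_re hB, PosDef.det_eq_re hA] at h
    exact_mod_cast h
  have hlog : Real.log A.det.re = Real.log (S * A * Sᴴ).det.re + Real.log B.det.re := by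
    rw [← hdet, Real.log_mul (PosDef.det_re_pos hX).ne' (PosDef.det_re_pos hB).ne']
  constructor
  · have := log_det_re_le_trace_sub_card hX
    rw [htr] at this
    linarith
  · intro h
    have h1 : S * A * Sᴴ = 1 := by
      apply eq_one_of_log_det_re_eq hX
      rw [htr]; linarith
    have h2 : A * Sᴴ * S = 1 := by
      have := mul_eq_one_comm.mp (show S * (A * Sᴴ) = 1 by rw [← Matrix.mul_assoc]; exact h1)
      exact this
    rw [Matrix.mul_assoc, ← hS] at h2
    calc A = A * (B⁻¹ * B) := by rw [Matrix.nonsing_inv_mul B hBu, Matrix.mul_one]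
      _ = B := by rw [← Matrix.mul_assoc, h2, Matrix.one_mul]

theorem det_add_smul_one {A : Matrix ι ι ℂ} (hA : A.IsHermitian) (t : ℝ) :
    (A + (t : ℂ) • (1 : Matrix ι ι ℂ)).det = ∏ i, ((hA.eigenvalues i + t : ℝ) : ℂ) := by
  have h := Matrix.eval_charpoly A (-(t : ℂ))
  rw [hA.charpoly_eq, Polynomial.eval_prod] at h
  have h2 : A + (t : ℂ) • (1 : Matrix ι ι ℂ) = -(Matrix.scalar ι (-(t : ℂ)) - A) := by
    ext i j
    simp [Matrix.one_apply, Matrix.diagonal_apply]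
    split_ifs <;> simp
  rw [h2, Matrix.det_neg, ← h]
  rw [← Finset.card_univ, ← Finset.prod_const, ← Finset.prod_mul_distrib]
  refine Finset.prod_congr rfl fun i _ => ?_
  simp

theorem posDef_sub_smul_one {𝕜 : Type*} [RCLike 𝕜] {A : Matrix ι ι 𝕜} (hA : A.IsHermitian) {c : ℝ}
    (hc : ∀ i, c < hA.eigenvalues i) : (A - (c : 𝕜) • (1 : Matrix ι ι 𝕜)).PosDef := by
  have hs : A - (c : 𝕜) • (1 : Matrix ι ι 𝕜) =
      Unitary.conjStarAlgAut 𝕜 _ hA.eigenvectorUnitary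
        (Matrix.diagonal fun i => ((hA.eigenvalues i - c : ℝ) : 𝕜)) := by
    have : (Matrix.diagonal fun i => ((hA.eigenvalues i - c : ℝ) : 𝕜)) =
        Matrix.diagonal (RCLike.ofReal ∘ hA.eigenvalues) - (c : 𝕜) • (1 : Matrix ι ι 𝕜) := by
      ext i j
      by_cases h : i = j <;> simp [h, Algebra.algebraMap_eq_smul_one, sub_smul]
    rw [this, map_sub, map_smul, map_one, ← hA.spectral_theorem]
  rw [hs, Unitary.conjStarAlgAut_apply]
  refine (Matrix.IsUnit.posDef_star_right_conjugate_iff Unitary.isUnit_coe).mpr ?_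
  refine Matrix.PosDef.diagonal fun i => ?_
  rw [RCLike.ofReal_pos]
  linarith [hc i]

/-- Otherwise $A-cI$ with $c=v^*Av$ would be positive definite, yet its quadratic form vanishes at
the unit vector $v$. -/
theorem exists_eigenvalue_le {A : Matrix ι ι ℂ} (hA : A.IsHermitian) (v : ι → ℂ)
    (hv : (star v ⬝ᵥ v).re = 1) : ∃ i, hA.eigenvalues i ≤ (star v ⬝ᵥ A *ᵥ v).re := by
  by_contra! hlt
  have hpos := posDef_sub_smul_one hA hlt
  have hv0 : v ≠ 0 := by
    rintro rfl
    simp at hv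
  have := hpos.re_dotProduct_pos hv0
  rw [Matrix.sub_mulVec, Matrix.smul_mulVec, Matrix.one_mulVec, dotProduct_sub,
    dotProduct_smul] at this
  simp [hv] at this

theorem log_det_re_add_smul_one_sub {A : Matrix ι ι ℂ} (hA : A.PosDef) {t : ℝ} (ht : 0 < t) :
    Real.log (A + (t : ℂ) • (1 : Matrix ι ι ℂ)).det.re =
      Real.log A.det.re + ∑ i, Real.log ((hA.1.eigenvalues i + t) / hA.1.eigenvalues i) := by
  rw [log_det_re_eq_sum hA, det_add_smul_one hA.1, ← Finset.sum_add_distrib, ← Complex.ofReal_prod,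
    Complex.ofReal_re, Real.log_prod fun i _ => by linarith [hA.eigenvalues_pos i]]
  refine Finset.sum_congr rfl fun i _ => ?_
  have := hA.eigenvalues_pos i
  rw [Real.log_div (by linarith) this.ne']
  ring

theorem log_det_re_le_add_smul_one {A : Matrix ι ι ℂ} (hA : A.PosDef) {t : ℝ} (ht : 0 < t) :
    Real.log A.det.re ≤ Real.log (A + (t : ℂ) • (1 : Matrix ι ι ℂ)).det.re := by
  rw [log_det_re_add_smul_one_sub hA ht]
  have : 0 ≤ ∑ i, Real.log ((hA.1.eigenvalues i + t) / hA.1.eigenvalues i) :=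
    Finset.sum_nonneg fun i _ => Real.log_nonneg (by
      rw [le_div_iff₀ (hA.eigenvalues_pos i)]; linarith)
  linarith

/-- A single eigenvalue $\mu\le g$ already contributes $\log((\mu+t)/\mu)\ge t/(\mu+t)\ge t/(g+t)$;
the others contribute nonnegative amounts. -/
theorem log_det_re_add_le_add_smul_one {A : Matrix ι ι ℂ} (hA : A.PosDef) {t : ℝ} (ht : 0 < t)
    (v : ι → ℂ) (hv : (star v ⬝ᵥ v).re = 1) {g : ℝ} (hg : (star v ⬝ᵥ A *ᵥ v).re ≤ g) :
    Real.log A.det.re + t / (g + t) ≤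
      Real.log (A + (t : ℂ) • (1 : Matrix ι ι ℂ)).det.re := by
  rw [log_det_re_add_smul_one_sub hA ht]
  obtain ⟨i, hi⟩ := exists_eigenvalue_le hA.1 v hv
  have hpos := hA.eigenvalues_pos i
  have h1 : Real.log ((hA.1.eigenvalues i + t) / hA.1.eigenvalues i) ≤
      ∑ i, Real.log ((hA.1.eigenvalues i + t) / hA.1.eigenvalues i) :=
    Finset.single_le_sum (f := fun i => Real.log ((hA.1.eigenvalues i + t) / hA.1.eigenvalues i))
      (fun i _ => Real.log_nonneg (by
      rw [le_div_iff₀ (hA.eigenvalues_pos i)]; linarith)) (Finset.mem_univ i)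
  have h2 := Real.one_sub_inv_le_log_of_pos
    (show 0 < (hA.1.eigenvalues i + t) / hA.1.eigenvalues i by positivity)
  have h3 : 1 - ((hA.1.eigenvalues i + t) / hA.1.eigenvalues i)⁻¹ =
      t / (hA.1.eigenvalues i + t) := by
    field_simp
    ring
  have h4 : t / (g + t) ≤ t / (hA.1.eigenvalues i + t) := by
    apply div_le_div_of_nonneg_left ht.le (by linarith)
    linarith
  linarith

/-- Hadamard's inequality with slack in the diagonal, read off from the tangent to $\log\det$ at
$\operatorname{diag}(d)$. The slack lets the diagonal of $\Sigma$ bound $\det(\Sigma-\Lambda)$. -/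
theorem log_det_re_le_sum_log {A : Matrix ι ι ℂ} (hA : A.PosDef) {d : ι → ℝ}
    (hd : ∀ k, (A k k).re ≤ d k) : Real.log A.det.re ≤ ∑ k, Real.log (d k) := by
  have hdpos : ∀ k, 0 < d k := fun k => (Complex.pos_iff.mp (hA.diag_pos (i := k))).1.trans_le (hd k)
  have hD : (Matrix.diagonal fun k => (d k : ℂ)).PosDef :=
    Matrix.PosDef.diagonal fun k => by exact_mod_cast hdpos k
  have h := (log_det_re_le hA hD).1
  have hinv : (Matrix.diagonal fun k => (d k : ℂ))⁻¹ = Matrix.diagonal fun k => ((d k)⁻¹ : ℂ) := by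
    apply Matrix.inv_eq_right_inv
    rw [Matrix.diagonal_mul_diagonal, ← Matrix.diagonal_one]
    congr 1
    funext k
    exact mul_inv_cancel₀ (by exact_mod_cast (hdpos k).ne')
  have htr : ((Matrix.diagonal fun k => (d k : ℂ))⁻¹ * A).trace.re ≤ Fintype.card ι := by
    rw [hinv, Matrix.trace, Complex.re_sum]
    calc _ ≤ ∑ _k : ι, (1 : ℝ) := Finset.sum_le_sum fun k _ => by
            rw [Matrix.diag_apply, Matrix.diagonal_mul, ← Complex.ofReal_inv,
              Complex.re_ofReal_mul, inv_mul_le_iff₀ (hdpos k)]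
            linarith [hd k]
      _ = _ := by simp
  have hdet : (Matrix.diagonal fun k => (d k : ℂ)).det.re = ∏ k, d k := by
    rw [Matrix.det_diagonal]
    norm_cast
  rw [hdet, Real.log_prod fun k _ => (hdpos k).ne'] at h
  linarith

theorem log_det_re_le_mul_trace {A : Matrix ι ι ℂ} (hA : A.PosDef) {c : ℝ} (hc : 0 < c) :
    Real.log A.det.re ≤ c * A.trace.re - Fintype.card ι * (Real.log c + 1) := by
  have hcA : ((c : ℂ) • A).PosDef := hA.smul (by exact_mod_cast hc)
  have h := log_det_re_le_trace_sub_card hcA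
  rw [Matrix.det_smul, Matrix.trace_smul, smul_eq_mul, Complex.re_ofReal_mul, ← Complex.ofReal_pow,
    Complex.re_ofReal_mul, Real.log_mul (by positivity) (PosDef.det_re_pos hA).ne', Real.log_pow] at h
  linarith

/-- Writing $A=S^*S$, the entries are inner products of columns of $S$, and Cauchy–Schwarz bounds
them by diagonal entries. -/
theorem norm_apply_le_trace_re {A : Matrix ι ι ℂ} (hA : A.PosSemidef) (a b : ι) :
    ‖A a b‖ ≤ A.trace.re := by
  have hdiag : ∀ k, 0 ≤ (A k k).re := fun k => (Complex.nonneg_iff.mp (hA.diag_nonneg (i := k))).1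
  have hle : ∀ k, (A k k).re ≤ A.trace.re := fun k => by
    rw [Matrix.trace, Complex.re_sum]
    exact Finset.single_le_sum (f := fun k => (A k k).re) (fun k _ => hdiag k) (Finset.mem_univ k)
  obtain ⟨S, hS⟩ := exists_eq_conjTranspose_mul_self hA
  have hent : ∀ x y, A x y = inner ℂ (WithLp.toLp 2 (fun i => S i x) : EuclideanSpace ℂ ι)
      (WithLp.toLp 2 (fun i => S i y)) := fun x y => by
    rw [hS]
    simp [Matrix.mul_apply, PiLp.inner_apply, mul_comm]
  have hsq : ∀ x, ‖(WithLp.toLp 2 (fun i => S i x) : EuclideanSpace ℂ ι)‖ ^ 2 = (A x x).re :=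
    fun x => by
      rw [hent, inner_self_eq_norm_sq_to_K]
      norm_cast
  have h := norm_inner_le_norm (𝕜 := ℂ) (WithLp.toLp 2 (fun i => S i a) : EuclideanSpace ℂ ι)
    (WithLp.toLp 2 (fun i => S i b))
  rw [← hent] at h
  have ha := (hsq a).trans_le (hle a)
  have hb := (hsq b).trans_le (hle b)
  nlinarith [sq_nonneg (‖(WithLp.toLp 2 (fun i => S i a) : EuclideanSpace ℂ ι)‖ -
    ‖(WithLp.toLp 2 (fun i => S i b) : EuclideanSpace ℂ ι)‖)]

end MatrixFacts

/-- $A^*A$ is unitarily similar to the diagonal matrix of squared eigenvalues of $A$. Comparing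
roots of the characteristic polynomials avoids matching the two orderings of eigenvalues. -/
theorem sumSingularValues_of_posSemidef {m : ℕ} {A : Matrix (Fin m) (Fin m) ℂ}
    (hA : A.PosSemidef) : sumSingularValues A = A.trace.re := by
  unfold sumSingularValues
  set hB := Matrix.isHermitian_conjTranspose_mul_self A
  have hchar : (Aᴴ * A).charpoly =
      (Matrix.diagonal fun i => ((hA.1.eigenvalues i ^ 2 : ℝ) : ℂ)).charpoly := by
    have h : Aᴴ * A = Unitary.conjStarAlgAut ℂ _ hA.1.eigenvectorUnitary
        (Matrix.diagonal fun i => ((hA.1.eigenvalues i ^ 2 : ℝ) : ℂ)) := by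
      rw [hA.1.eq]
      conv_lhs => rw [hA.1.spectral_theorem, ← map_mul, Matrix.diagonal_mul_diagonal]
      congr 2
      funext i
      simp [sq]
    rw [h, Unitary.conjStarAlgAut_apply, Matrix.charpoly_mul_comm, ← mul_assoc]
    simp
  have hroots := hB.roots_charpoly_eq_eigenvalues
  rw [hchar, Matrix.charpoly_diagonal, Polynomial.roots_prod _ _
    (Finset.prod_ne_zero_iff.mpr fun i _ => Polynomial.X_sub_C_ne_zero _)] at hroots
  have h := congrArg (fun s : Multiset ℂ => (s.map fun z => Real.sqrt z.re).sum) hroots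
  simp only [Polynomial.roots_X_sub_C, Multiset.bind_singleton, Multiset.map_map,
    Function.comp_apply, Complex.ofReal_re] at h
  rw [trace_re_eq_sum hA.1]
  have h2 : ∑ i, Real.sqrt (hA.1.eigenvalues i ^ 2) = ∑ i, Real.sqrt (hB.eigenvalues i) := h
  rw [← h2]
  exact Finset.sum_congr rfl fun i _ => Real.sqrt_sq (hA.eigenvalues_nonneg i)

/-! ### Means over the circle -/

theorem mean_add {f g : ℝ → ℝ} (hf : Continuous f) (hg : Continuous g) :
    mean (fun θ => f θ + g θ) = mean f + mean g := by
  unfold mean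
  rw [intervalIntegral.integral_add (hf.intervalIntegrable _ _) (hg.intervalIntegrable _ _), mul_add]

theorem mean_const_mul (c : ℝ) (f : ℝ → ℝ) : mean (fun θ => c * f θ) = c * mean f := by
  unfold mean
  rw [intervalIntegral.integral_const_mul]
  ring

theorem mean_neg (f : ℝ → ℝ) : mean (fun θ => -f θ) = -mean f := by
  unfold mean
  rw [intervalIntegral.integral_neg]
  ring

theorem mean_sub {f g : ℝ → ℝ} (hf : Continuous f) (hg : Continuous g) :
    mean (fun θ => f θ - g θ) = mean f - mean g := by
  simp only [sub_eq_add_neg]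
  rw [mean_add (g := fun θ => -g θ) hf hg.neg, mean_neg]

theorem mean_const (c : ℝ) : mean (fun _ => c) = c := by
  unfold mean
  rw [intervalIntegral.integral_const, smul_eq_mul]
  have := Real.pi_pos
  field_simp
  ring

theorem mean_mono {f g : ℝ → ℝ} (hf : Continuous f) (hg : Continuous g) (h : ∀ θ, f θ ≤ g θ) :
    mean f ≤ mean g := by
  unfold mean
  have := Real.pi_pos
  gcongr
  exact intervalIntegral.integral_mono_on (by linarith) (hf.intervalIntegrable _ _)
    (hg.intervalIntegrable _ _) fun θ _ => h θ

theorem mean_nonneg {f : ℝ → ℝ} (h : ∀ θ, 0 ≤ f θ) : 0 ≤ mean f := by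
  unfold mean
  have := Real.pi_pos
  exact mul_nonneg (by positivity)
    (intervalIntegral.integral_nonneg (by linarith) fun θ _ => h θ)

theorem cmean_sum {ι : Type*} (s : Finset ι) {f : ι → ℝ → ℂ} (hf : ∀ i ∈ s, Continuous (f i)) :
    cmean (fun θ => ∑ i ∈ s, f i θ) = ∑ i ∈ s, cmean (f i) := by
  unfold cmean
  rw [intervalIntegral.integral_finsetSum fun i hi => (hf i hi).intervalIntegrable _ _,
    Finset.smul_sum]

theorem cmean_mul_const (f : ℝ → ℂ) (c : ℂ) : cmean (fun θ => f θ * c) = cmean f * c := by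
  unfold cmean
  rw [intervalIntegral.integral_mul_const, smul_mul_assoc]

theorem cmean_re {f : ℝ → ℂ} (hf : Continuous f) : (cmean f).re = mean fun θ => (f θ).re := by
  unfold cmean mean
  rw [Complex.smul_re, smul_eq_mul]
  congr 1
  exact (Complex.reCLM.intervalIntegral_comp_comm (hf.intervalIntegrable _ _)).symm

theorem norm_cmean_le {f : ℝ → ℂ} : ‖cmean f‖ ≤ mean fun θ => ‖f θ‖ := by
  unfold cmean mean
  have := Real.pi_pos
  rw [norm_smul, Real.norm_of_nonneg (by positivity)]
  gcongr
  exact intervalIntegral.norm_integral_le_integral_norm (by linarith)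

theorem cmean_exp (k : ℤ) :
    cmean (fun θ => Complex.exp (Complex.I * (k : ℂ) * (θ : ℂ))) = if k = 0 then 1 else 0 := by
  unfold cmean
  have hpi := Real.pi_pos
  split_ifs with h
  · subst h
    simp
    have : (Real.pi : ℂ) ≠ 0 := by exact_mod_cast hpi.ne'
    field_simp
    ring
  · have hk : Complex.I * (k : ℂ) ≠ 0 := mul_ne_zero Complex.I_ne_zero (by exact_mod_cast h)
    rw [integral_exp_mul_complex hk]
    have : Complex.exp (Complex.I * k * (Real.pi : ℝ)) =
        Complex.exp (Complex.I * k * ((-Real.pi : ℝ) : ℂ)) := by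
      rw [Complex.exp_eq_exp_iff_exists_int]
      exact ⟨k, by push_cast; ring⟩
    rw [this, sub_self, zero_div, smul_zero]

/-! ### Pseudo-polynomials and their coefficients -/

variable {m n : ℕ}

theorem symbol_apply (R : ℤ → Matrix (Fin m) (Fin m) ℝ) (θ : ℝ) (a b : Fin m) :
    symbol n R θ a b = ∑ j ∈ Finset.Icc (-(n : ℤ)) (n : ℤ),
      Complex.exp (-(Complex.I * (j : ℂ) * (θ : ℂ))) * (R j a b : ℂ) := by
  simp [symbol, Matrix.sum_apply]

theorem continuous_symbol (R : ℤ → Matrix (Fin m) (Fin m) ℝ) : Continuous (symbol n R) := by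
  refine continuous_pi fun a => continuous_pi fun b => ?_
  simp only [symbol_apply]
  fun_prop

theorem continuous_symbol_apply (R : ℤ → Matrix (Fin m) (Fin m) ℝ) (a b : Fin m) :
    Continuous fun θ => symbol n R θ a b := by
  simp only [symbol_apply]
  fun_prop

theorem symbol_periodic (R : ℤ → Matrix (Fin m) (Fin m) ℝ) :
    Function.Periodic (symbol n R) (2 * Real.pi) := by
  intro θ
  ext a b
  rw [symbol_apply, symbol_apply]
  refine Finset.sum_congr rfl fun j _ => ?_
  congr 1
  rw [Complex.exp_eq_exp_iff_exists_int]
  exact ⟨-j, by push_cast; ring⟩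

theorem symbol_isHermitian {R : ℤ → Matrix (Fin m) (Fin m) ℝ} (hR : IsLagSequence R) (θ : ℝ) :
    (symbol n R θ).IsHermitian := by
  ext a b
  rw [Matrix.conjTranspose_apply, symbol_apply, symbol_apply, star_sum]
  refine Finset.sum_nbij' (fun j => -j) (fun j => -j) ?_ ?_ ?_ ?_ ?_
  · intro j hj; simp only [Finset.mem_Icc] at hj ⊢; omega
  · intro j hj; simp only [Finset.mem_Icc] at hj ⊢; omega
  · intro j _; simp
  · intro j _; simp
  · intro j _
    rw [hR j, Matrix.transpose_apply]
    simp [← Complex.exp_conj]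

theorem cmean_exp_mul_exp (k j : ℤ) (c : ℂ) :
    cmean (fun θ => Complex.exp (Complex.I * (k : ℂ) * (θ : ℂ)) *
      (Complex.exp (-(Complex.I * (j : ℂ) * (θ : ℂ))) * c)) = if k = j then c else 0 := by
  have : ∀ θ : ℝ, Complex.exp (Complex.I * (k : ℂ) * (θ : ℂ)) *
      (Complex.exp (-(Complex.I * (j : ℂ) * (θ : ℂ))) * c) =
      Complex.exp (Complex.I * ((k - j : ℤ) : ℂ) * (θ : ℂ)) * c := fun θ => by
    rw [← mul_assoc, ← Complex.exp_add]
    congr 2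
    push_cast
    ring
  simp only [this]
  rw [cmean_mul_const, cmean_exp]
  by_cases h : k = j
  · simp [h]
  · simp [h, sub_eq_zero]

theorem lagCoeff_symbol_apply (R : ℤ → Matrix (Fin m) (Fin m) ℝ) (k : ℤ) (a b : Fin m) :
    lagCoeff (symbol n R) k a b =
      if k ∈ Finset.Icc (-(n : ℤ)) (n : ℤ) then (R k a b : ℂ) else 0 := by
  simp only [lagCoeff, Matrix.of_apply, symbol_apply, Finset.mul_sum]
  rw [cmean_sum _ fun j _ => by fun_prop]
  simp only [cmean_exp_mul_exp]
  rw [Finset.sum_ite_eq]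

theorem eq_zero_of_symbol_eq_zero {R : ℤ → Matrix (Fin m) (Fin m) ℝ} (h : symbol n R = 0)
    {j : ℤ} (hj : j ∈ Finset.Icc (-(n : ℤ)) (n : ℤ)) : R j = 0 := by
  ext a b
  have h1 := lagCoeff_symbol_apply (n := n) R j a b
  rw [h, if_pos hj] at h1
  have h2 : lagCoeff (0 : CircleFn m) j a b = 0 := by
    simp [lagCoeff, cmean]
  rw [h2] at h1
  exact_mod_cast h1.symm

/-- The pairing `∫ ⟨F, Φ⟩` in terms of the coefficients. -/
noncomputable def lagPairing (n : ℕ) (S R : ℤ → Matrix (Fin m) (Fin m) ℝ) : ℝ :=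
  ∑ j ∈ Finset.Icc (-(n : ℤ)) (n : ℤ), ∑ a, ∑ b, S j a b * R j a b

theorem mean_trace_symbol_mul (S R : ℤ → Matrix (Fin m) (Fin m) ℝ) :
    mean (fun θ => (symbol n S θ * (symbol n R θ)ᴴ).trace.re) = lagPairing n S R := by
  have hexp : ∀ θ, (symbol n S θ * (symbol n R θ)ᴴ).trace =
      ∑ j ∈ Finset.Icc (-(n : ℤ)) (n : ℤ), ∑ a, ∑ b,
        Complex.exp (Complex.I * (j : ℂ) * (θ : ℂ)) * symbol n S θ a b * (R j a b : ℂ) := by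
    intro θ
    simp only [Matrix.trace, Matrix.diag_apply, Matrix.mul_apply, Matrix.conjTranspose_apply]
    rw [Finset.sum_comm (s := Finset.Icc (-(n : ℤ)) (n : ℤ))]
    refine Finset.sum_congr rfl fun a _ => ?_
    rw [Finset.sum_comm (s := Finset.Icc (-(n : ℤ)) (n : ℤ))]
    refine Finset.sum_congr rfl fun b _ => ?_
    rw [symbol_apply R, star_sum, Finset.mul_sum]
    refine Finset.sum_congr rfl fun j _ => ?_
    simp [← Complex.exp_conj]
    ring
  have hc : Continuous fun θ => (symbol n S θ * (symbol n R θ)ᴴ).trace :=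
    ((continuous_symbol S).matrix_mul (continuous_symbol R).matrix_conjTranspose).matrix_trace
  rw [← cmean_re hc]
  simp only [hexp]
  have hcS : ∀ a b, Continuous fun θ => symbol n S θ a b := continuous_symbol_apply S
  rw [cmean_sum _ fun j _ => by fun_prop]
  unfold lagPairing
  rw [Complex.re_sum]
  refine Finset.sum_congr rfl fun j hj => ?_
  rw [cmean_sum _ fun a _ => by fun_prop, Complex.re_sum]
  refine Finset.sum_congr rfl fun a _ => ?_
  rw [cmean_sum _ fun b _ => by fun_prop, Complex.re_sum]
  refine Finset.sum_congr rfl fun b _ => ?_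
  rw [cmean_mul_const]
  have h := lagCoeff_symbol_apply (n := n) S j a b
  rw [if_pos hj] at h
  simp only [lagCoeff, Matrix.of_apply] at h
  rw [h]
  norm_cast

theorem continuous_trace_symbol (S : ℤ → Matrix (Fin m) (Fin m) ℝ) :
    Continuous fun θ => (symbol n S θ).trace.re :=
  Complex.continuous_re.comp (continuous_symbol S).matrix_trace

theorem mean_trace_symbol (S : ℤ → Matrix (Fin m) (Fin m) ℝ) :
    mean (fun θ => (symbol n S θ).trace.re) = (S 0).trace := by
  rw [← cmean_re (continuous_symbol S).matrix_trace]
  simp only [Matrix.trace, Matrix.diag_apply]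
  rw [cmean_sum _ fun a _ => continuous_symbol_apply S a a, Complex.re_sum]
  refine Finset.sum_congr rfl fun a _ => ?_
  have h := lagCoeff_symbol_apply (n := n) S 0 a a
  rw [if_pos (by simp)] at h
  simp only [lagCoeff, Matrix.of_apply, Int.cast_zero, mul_zero, zero_mul, Complex.exp_zero,
    one_mul] at h
  rw [h, Complex.ofReal_re]

/-- The coefficient is the mean of a unimodular function times an entry, and entries of a positive
semidefinite matrix are at most its trace. A bound on $\operatorname{tr}S_0$ therefore bounds all
coefficients, which is the source of compactness. -/
theorem abs_lag_le_trace {S : ℤ → Matrix (Fin m) (Fin m) ℝ} (hS : PosSemidefOn (symbol n S))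
    {j : ℤ} (hj : j ∈ Finset.Icc (-(n : ℤ)) (n : ℤ)) (a b : Fin m) :
    |S j a b| ≤ (S 0).trace := by
  have h := lagCoeff_symbol_apply (n := n) S j a b
  rw [if_pos hj] at h
  have h2 : |S j a b| = ‖lagCoeff (symbol n S) j a b‖ := by
    rw [h, Complex.norm_real, Real.norm_eq_abs]
  rw [h2, ← mean_trace_symbol (n := n) S]
  simp only [lagCoeff, Matrix.of_apply]
  have hc := continuous_symbol_apply (n := n) S a b
  refine norm_cmean_le.trans (mean_mono (by fun_prop) (continuous_trace_symbol S) fun θ => ?_)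
  rw [norm_mul]
  have : ‖Complex.exp (Complex.I * (j : ℂ) * (θ : ℂ))‖ = 1 := by
    rw [show Complex.I * (j : ℂ) * (θ : ℂ) = ((j * θ : ℝ) : ℂ) * Complex.I by push_cast; ring]
    exact Complex.norm_exp_ofReal_mul_I _
  rw [this, one_mul]
  exact norm_apply_le_trace_re (hS θ) a b

/-- Frequency $j$ is multiplied by $2(\cos js-1)$, of modulus at most $j^2s^2\le n^2s^2$, and there
are $2n+1$ frequencies. -/
theorem norm_symbol_second_difference_le {S : ℤ → Matrix (Fin m) (Fin m) ℝ} {M : ℝ}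
    (hM : ∀ j ∈ Finset.Icc (-(n : ℤ)) (n : ℤ), ∀ a b, |S j a b| ≤ M) (θ s : ℝ) (a b : Fin m) :
    ‖symbol n S (θ + s) a b + symbol n S (θ - s) a b - 2 * symbol n S θ a b‖ ≤
      (2 * n + 1) * n ^ 2 * M * s ^ 2 := by
  simp only [symbol_apply]
  rw [← Finset.sum_add_distrib, Finset.mul_sum, ← Finset.sum_sub_distrib]
  have hcard : ((Finset.Icc (-(n : ℤ)) (n : ℤ)).card : ℝ) = 2 * n + 1 := by
    rw [Int.card_Icc]
    have : ((n : ℤ) + 1 - -(n : ℤ)).toNat = 2 * n + 1 := by omega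
    rw [this]; push_cast; ring
  refine (norm_sum_le_of_le (f := _) _ (n := fun _ => (n : ℝ) ^ 2 * M * s ^ 2) fun j hj => ?_).trans ?_
  · have h1 : Complex.exp (-(Complex.I * (j : ℂ) * ((θ + s : ℝ) : ℂ))) * (S j a b : ℂ) +
        Complex.exp (-(Complex.I * (j : ℂ) * ((θ - s : ℝ) : ℂ))) * (S j a b : ℂ) -
        2 * (Complex.exp (-(Complex.I * (j : ℂ) * (θ : ℂ))) * (S j a b : ℂ)) =
        Complex.exp (((-(j * θ) : ℝ) : ℂ) * Complex.I) *
          ((2 * (Real.cos (j * s) - 1) * S j a b : ℝ) : ℂ) := by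
      have e1 : Complex.exp (-(Complex.I * (j : ℂ) * ((θ + s : ℝ) : ℂ))) =
          Complex.exp (((-(j * θ) : ℝ) : ℂ) * Complex.I) * Complex.exp (-((j * s : ℝ) : ℂ) * Complex.I) := by
        rw [← Complex.exp_add]; congr 1; push_cast; ring
      have e2 : Complex.exp (-(Complex.I * (j : ℂ) * ((θ - s : ℝ) : ℂ))) =
          Complex.exp (((-(j * θ) : ℝ) : ℂ) * Complex.I) * Complex.exp (((j * s : ℝ) : ℂ) * Complex.I) := by
        rw [← Complex.exp_add]; congr 1; push_cast; ring
      have e3 : Complex.exp (-(Complex.I * (j : ℂ) * (θ : ℂ))) =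
          Complex.exp (((-(j * θ) : ℝ) : ℂ) * Complex.I) := by
        congr 1; push_cast; ring
      have e4 := Complex.two_cos ((j * s : ℝ) : ℂ)
      rw [e1, e2, e3]
      rw [show ((2 * (Real.cos (j * s) - 1) * S j a b : ℝ) : ℂ) =
        (2 * Complex.cos ((j * s : ℝ) : ℂ) - 2) * (S j a b : ℂ) by push_cast; ring, e4]
      ring
    rw [h1, norm_mul, Complex.norm_exp_ofReal_mul_I, one_mul, Complex.norm_real, Real.norm_eq_abs,
      abs_mul]
    have hcos := Real.one_sub_sq_div_two_le_cos (x := j * s)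
    have hcos1 := Real.cos_le_one (j * s)
    have h2 : |2 * (Real.cos (j * s) - 1)| ≤ (j * s) ^ 2 := by
      rw [abs_of_nonpos (by linarith)]; linarith
    have hj2 : (j : ℝ) ^ 2 ≤ (n : ℝ) ^ 2 := by
      rw [Finset.mem_Icc] at hj
      have h3 : (-(n : ℝ)) ≤ (j : ℝ) := by exact_mod_cast hj.1
      have h4 : (j : ℝ) ≤ (n : ℝ) := by exact_mod_cast hj.2
      nlinarith
    calc |2 * (Real.cos (j * s) - 1)| * |S j a b| ≤ ((n : ℝ) ^ 2 * s ^ 2) * M := by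
          apply mul_le_mul _ (hM j hj a b) (abs_nonneg _) (by positivity)
          refine h2.trans ?_
          rw [mul_pow]
          gcongr
      _ = _ := by ring
  · rw [Finset.sum_const, nsmul_eq_mul, hcard]
    apply le_of_eq; ring

/-! ### Positivity of the pairing with a positive definite Toeplitz matrix -/

/-- Equal Gram matrices make $x_i\mapsto y_i$ isometric on the span of the $x_i$; finite dimension
allows an extension to all of $V$. -/
theorem exists_linearIsometry_of_gram_eq {ι V : Type*} [NormedAddCommGroup V]
    [InnerProductSpace ℝ V] [FiniteDimensional ℝ V] {x y : ι → V} (hx : LinearIndependent ℝ x)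
    (h : ∀ i j, inner ℝ (x i) (x j) = inner ℝ (y i) (y j)) :
    ∃ U : V →ₗᵢ[ℝ] V, ∀ i, U (x i) = y i := by
  let b := Module.Basis.span hx
  let L : Submodule.span ℝ (Set.range x) →ₗ[ℝ] V := b.constr ℝ y
  have hL : ∀ i, L (b i) = y i := fun i => b.constr_basis ℝ y i
  have hb : ∀ i, (b i : V) = x i := fun i => by rw [Module.Basis.span_apply]
  have hinner : ∀ u v, inner ℝ (L u) (L v) = inner ℝ u v := by
    have : (innerₗ V).compl₁₂ L L = innerₗ (Submodule.span ℝ (Set.range x)) := by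
      refine b.ext fun i => b.ext fun j => ?_
      simp only [LinearMap.compl₁₂_apply, innerₗ_apply_apply, hL, Submodule.coe_inner, hb, h]
    intro u v
    have h2 := LinearMap.congr_fun (LinearMap.congr_fun this u) v
    simpa using h2
  refine ⟨(L.isometryOfInner hinner).extend, fun i => ?_⟩
  have h1 := (L.isometryOfInner hinner).extend_apply (b i)
  rw [hb] at h1
  rw [h1]
  exact hL i

/-- A positive definite block Toeplitz matrix consists of the correlations of the orbit of an
isometry. -/
theorem exists_orbit_of_blockToeplitz_posDef {R : ℤ → Matrix (Fin m) (Fin m) ℝ}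
    (hR : IsLagSequence R) (hpos : (blockToeplitz n R).PosDef) :
    ∃ X : ℕ → Fin m → EuclideanSpace ℝ (Fin (n + 1) × Fin m), ∀ h k : ℕ,
      ((k : ℤ) - h) ∈ Finset.Icc (-(n : ℤ)) (n : ℤ) → ∀ a b,
        inner ℝ (X h a) (X k b) = R ((k : ℤ) - h) a b := by
  -- The columns $\xi_{(k,b)}$ of a factor $B$ have the Toeplitz matrix as Gram matrix.
  obtain ⟨B, hB⟩ := exists_eq_conjTranspose_mul_self hpos.posSemidef
  let ξ : Fin (n + 1) × Fin m → EuclideanSpace ℝ (Fin (n + 1) × Fin m) :=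
    fun q => WithLp.toLp 2 fun i => B i q
  have hξ : ∀ p q, inner ℝ (ξ p) (ξ q) = R (((q.1 : ℕ) : ℤ) - ((p.1 : ℕ) : ℤ)) p.2 q.2 := by
    intro p q
    have : blockToeplitz n R p q = R (((q.1 : ℕ) : ℤ) - ((p.1 : ℕ) : ℤ)) p.2 q.2 := rfl
    rw [← this, hB]
    simp [ξ, PiLp.inner_apply, Matrix.mul_apply, mul_comm]
  have hgram : Matrix.gram ℝ ξ = blockToeplitz n R := by
    ext p q
    rw [Matrix.gram_apply, hξ]
    rfl
  have hli : LinearIndependent ℝ ξ :=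
    Matrix.posDef_gram_iff_linearIndependent.mp (hgram ▸ hpos)
  -- The Toeplitz structure says that shifting the block index by one preserves the Gram matrix, so
  -- an isometry $U$ carries block $k$ to block $k+1$. Iterating $U$ beyond block $n$ continues the
  -- correlations indefinitely.
  obtain ⟨U, hU⟩ := exists_linearIsometry_of_gram_eq
    (x := fun p : Fin n × Fin m => ξ (p.1.castSucc, p.2))
    (y := fun p : Fin n × Fin m => ξ (p.1.succ, p.2))
    (hli.comp _ fun p q hpq => by
      simp only [Prod.mk.injEq, Fin.castSucc_inj] at hpq
      exact Prod.ext hpq.1 hpq.2)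
    (fun p q => by
      rw [hξ, hξ]
      simp)
  have hinner : ∀ (k : ℕ) (u v), inner ℝ (U^[k] u) (U^[k] v) = inner ℝ u v := by
    intro k
    induction k with
    | zero => simp
    | succ k ih => intro u v; rw [Function.iterate_succ_apply', Function.iterate_succ_apply',
        U.inner_map_map, ih]
  have horbit : ∀ (k : ℕ) (hk : k < n + 1) (b : Fin m), U^[k] (ξ (0, b)) = ξ (⟨k, hk⟩, b) := by
    intro k
    induction k with
    | zero => intro _ b; rfl
    | succ k ih =>
      intro hk b
      rw [Function.iterate_succ_apply', ih (by omega)]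
      exact hU (⟨k, by omega⟩, b)
  have hforward : ∀ h k : ℕ, h ≤ k → k - h < n + 1 → ∀ a b,
      inner ℝ (U^[h] (ξ (0, a))) (U^[k] (ξ (0, b))) = R ((k : ℤ) - h) a b := by
    intro h k hhk hkn a b
    obtain ⟨d, rfl⟩ := Nat.exists_eq_add_of_le hhk
    rw [Function.iterate_add_apply, hinner, horbit d (by omega), hξ]
    simp
  refine ⟨fun k a => U^[k] (ξ (0, a)), fun h k hmem a b => ?_⟩
  rw [Finset.mem_Icc] at hmem
  rcases le_total h k with hhk | hhk
  · exact hforward h k hhk (by omega) a b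
  · rw [real_inner_comm, hforward k h hhk (by omega) b a, ← neg_sub (k : ℤ) h, hR]
    rfl

/-- The form is the mean over $\theta$ of $v(\theta)^*S(e^{i\theta})v(\theta)$ with
$v(\theta)=\sum_k e^{ik\theta}x_k$. -/
theorem toeplitz_form_nonneg {S : ℤ → Matrix (Fin m) (Fin m) ℝ} (hS : PosSemidefOn (symbol n S))
    (N : ℕ) (x : ℕ → Fin m → ℝ) :
    0 ≤ ∑ h ∈ Finset.range N, ∑ k ∈ Finset.range N, ∑ a, ∑ b,
      (if ((k : ℤ) - h) ∈ Finset.Icc (-(n : ℤ)) (n : ℤ) then S ((k : ℤ) - h) a b else 0) *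
        (x h a * x k b) := by
  have hform : ∀ θ : ℝ, 0 ≤ (∑ h ∈ Finset.range N, ∑ k ∈ Finset.range N, ∑ a, ∑ b,
      Complex.exp (Complex.I * (((k : ℤ) - (h : ℤ) : ℤ) : ℂ) * (θ : ℂ)) * symbol n S θ a b *
        ((x h a * x k b : ℝ) : ℂ)).re := by
    intro θ
    have h0 := (hS θ).re_dotProduct_nonneg fun a => ∑ k ∈ Finset.range N,
      Complex.exp (Complex.I * (k : ℂ) * (θ : ℂ)) * (x k a : ℂ)
    refine h0.trans_eq (congrArg Complex.re ?_)
    simp only [dotProduct, Matrix.mulVec, Pi.star_apply, star_sum, Finset.mul_sum, Finset.sum_mul]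
    have hL : ∀ a b : Fin m, ∀ k h : ℕ,
        star (Complex.exp (Complex.I * (h : ℂ) * (θ : ℂ)) * (x h a : ℂ)) *
          (symbol n S θ a b * (Complex.exp (Complex.I * (k : ℂ) * (θ : ℂ)) * (x k b : ℂ))) =
        Complex.exp (Complex.I * (((k : ℤ) - (h : ℤ) : ℤ) : ℂ) * (θ : ℂ)) * symbol n S θ a b *
          ((x h a * x k b : ℝ) : ℂ) := by
      intro a b k h
      have : Complex.exp (Complex.I * (((k : ℤ) - (h : ℤ) : ℤ) : ℂ) * (θ : ℂ)) =
          star (Complex.exp (Complex.I * (h : ℂ) * (θ : ℂ))) *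
            Complex.exp (Complex.I * (k : ℂ) * (θ : ℂ)) := by
        simp only [Complex.star_def, ← Complex.exp_conj, ← Complex.exp_add]
        congr 1
        simp
        ring
      rw [this]
      simp
      ring
    simp only [hL]
    calc _ = ∑ a, ∑ b, ∑ h ∈ Finset.range N, ∑ k ∈ Finset.range N,
          Complex.exp (Complex.I * (((k : ℤ) - (h : ℤ) : ℤ) : ℂ) * (θ : ℂ)) * symbol n S θ a b *
          ((x h a * x k b : ℝ) : ℂ) := by
            exact Finset.sum_congr rfl fun a _ => Finset.sum_congr rfl fun b _ => Finset.sum_comm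
      _ = ∑ a, ∑ h ∈ Finset.range N, ∑ b, ∑ k ∈ Finset.range N,
          Complex.exp (Complex.I * (((k : ℤ) - (h : ℤ) : ℤ) : ℂ) * (θ : ℂ)) * symbol n S θ a b *
          ((x h a * x k b : ℝ) : ℂ) :=
            Finset.sum_congr rfl fun a _ => Finset.sum_comm
      _ = ∑ h ∈ Finset.range N, ∑ a, ∑ k ∈ Finset.range N, ∑ b,
          Complex.exp (Complex.I * (((k : ℤ) - (h : ℤ) : ℤ) : ℂ) * (θ : ℂ)) * symbol n S θ a b *
          ((x h a * x k b : ℝ) : ℂ) := by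
            rw [Finset.sum_comm]
            exact Finset.sum_congr rfl fun h _ => Finset.sum_congr rfl fun a _ => Finset.sum_comm
      _ = _ := Finset.sum_congr rfl fun h _ => Finset.sum_comm
  have hc := continuous_symbol_apply (n := n) S
  refine (mean_nonneg hform).trans_eq ?_
  rw [← cmean_re (by fun_prop), cmean_sum _ fun h _ => by fun_prop, Complex.re_sum]
  refine Finset.sum_congr rfl fun h _ => ?_
  rw [cmean_sum _ fun k _ => by fun_prop, Complex.re_sum]
  refine Finset.sum_congr rfl fun k _ => ?_
  rw [cmean_sum _ fun a _ => by fun_prop, Complex.re_sum]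
  refine Finset.sum_congr rfl fun a _ => ?_
  rw [cmean_sum _ fun b _ => by fun_prop, Complex.re_sum]
  refine Finset.sum_congr rfl fun b _ => ?_
  rw [cmean_mul_const]
  have hl := lagCoeff_symbol_apply (n := n) S ((k : ℤ) - h) a b
  simp only [lagCoeff, Matrix.of_apply] at hl
  rw [hl]
  split_ifs
  · rw [← Complex.ofReal_mul, Complex.ofReal_re]
  · simp

/-- All rows $h$ except the first and last $n$ contribute the complete sum $L$, and the $2n$
boundary rows at most $B$ each. So $KL+2nB\ge0$ for every $K$, which excludes $L<0$. -/
theorem sum_nonneg_of_cesaro_nonneg {c : ℤ → ℝ}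
    (hc : ∀ j, j ∉ Finset.Icc (-(n : ℤ)) (n : ℤ) → c j = 0)
    (h : ∀ N : ℕ, 0 ≤ ∑ h ∈ Finset.range N, ∑ k ∈ Finset.range N, c ((k : ℤ) - h)) :
    0 ≤ ∑ j ∈ Finset.Icc (-(n : ℤ)) (n : ℤ), c j := by
  set L := ∑ j ∈ Finset.Icc (-(n : ℤ)) (n : ℤ), c j with hL
  set B := ∑ j ∈ Finset.Icc (-(n : ℤ)) (n : ℤ), |c j|
  have hB0 : 0 ≤ B := Finset.sum_nonneg fun _ _ => abs_nonneg _
  have himage : ∀ N h : ℕ, ∑ k ∈ Finset.range N, c ((k : ℤ) - h) =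
      ∑ j ∈ (Finset.Icc (-(n : ℤ)) (n : ℤ)).filter (fun j => -(h : ℤ) ≤ j ∧ j < N - h), c j := by
    intro N h
    rw [← Finset.sum_filter_add_sum_filter_not (Finset.range N)
      (fun k : ℕ => ((k : ℤ) - h) ∈ Finset.Icc (-(n : ℤ)) (n : ℤ))]
    rw [Finset.sum_eq_zero (s := (Finset.range N).filter
      (fun k : ℕ => ¬ ((k : ℤ) - h) ∈ Finset.Icc (-(n : ℤ)) (n : ℤ)))
      (fun k hk => hc _ (Finset.mem_filter.mp hk).2), add_zero]
    refine Finset.sum_nbij' (fun k => (k : ℤ) - h) (fun j => (j + h).toNat) ?_ ?_ ?_ ?_ ?_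
    · intro k hk
      simp only [Finset.mem_filter, Finset.mem_range, Finset.mem_Icc] at hk ⊢
      omega
    · intro j hj
      simp only [Finset.mem_filter, Finset.mem_range, Finset.mem_Icc] at hj ⊢
      omega
    · intro k _
      simp
    · intro j hj
      simp only [Finset.mem_filter, Finset.mem_Icc] at hj
      omega
    · intro k _; rfl
  have hle : ∀ N h : ℕ, ∑ k ∈ Finset.range N, c ((k : ℤ) - h) ≤ B := fun N h => by
    rw [himage]
    calc _ ≤ ∑ j ∈ (Finset.Icc (-(n : ℤ)) (n : ℤ)).filter
            (fun j => -(h : ℤ) ≤ j ∧ j < N - h), |c j| :=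
          Finset.sum_le_sum fun _ _ => le_abs_self _
      _ ≤ B := Finset.sum_le_sum_of_subset_of_nonneg (Finset.filter_subset _ _)
          fun _ _ _ => abs_nonneg _
  have hmid : ∀ N h : ℕ, n ≤ h → h + n < N → ∑ k ∈ Finset.range N, c ((k : ℤ) - h) = L := by
    intro N h h1 h2
    rw [himage, Finset.filter_true_of_mem]
    intro j hj
    rw [Finset.mem_Icc] at hj
    omega
  have hK : ∀ K : ℕ, 0 ≤ K * L + 2 * n * B := by
    intro K
    have h0 := h (n + K + n)
    rw [Finset.sum_range_add, Finset.sum_range_add] at h0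
    have b1 : ∑ h ∈ Finset.range n, ∑ k ∈ Finset.range (n + K + n), c ((k : ℤ) - h) ≤ n * B := by
      calc _ ≤ ∑ _h ∈ Finset.range n, B := Finset.sum_le_sum fun h _ => hle _ _
        _ = n * B := by simp
    have b2 : ∑ h ∈ Finset.range K, ∑ k ∈ Finset.range (n + K + n), c ((k : ℤ) - (n + h : ℕ)) =
        K * L := by
      calc _ = ∑ _h ∈ Finset.range K, L := Finset.sum_congr rfl fun h hh => by
              rw [Finset.mem_range] at hh
              exact hmid _ _ (by omega) (by omega)
        _ = K * L := by simp
    have b3 : ∑ h ∈ Finset.range n, ∑ k ∈ Finset.range (n + K + n), c ((k : ℤ) - (n + K + h : ℕ)) ≤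
        n * B := by
      calc _ ≤ ∑ _h ∈ Finset.range n, B := Finset.sum_le_sum fun h _ => hle _ _
        _ = n * B := by simp
    linarith
  by_contra! hneg
  obtain ⟨K, hK'⟩ := exists_nat_gt (2 * n * B / (-L))
  rw [div_lt_iff₀ (by linarith)] at hK'
  linarith [hK K]

/-- Replacing $R_{k-h}$ by inner products of orbit vectors splits the truncated double sums into
Toeplitz forms of $S$, one for each coordinate $p$ of the Euclidean space. -/
theorem lagPairing_nonneg {R S : ℤ → Matrix (Fin m) (Fin m) ℝ} (hR : IsLagSequence R)
    (hpos : (blockToeplitz n R).PosDef) (hS : PosSemidefOn (symbol n S)) :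
    0 ≤ lagPairing n S R := by
  obtain ⟨X, hX⟩ := exists_orbit_of_blockToeplitz_posDef hR hpos
  let c : ℤ → ℝ := fun j =>
    if j ∈ Finset.Icc (-(n : ℤ)) (n : ℤ) then ∑ a, ∑ b, S j a b * R j a b else 0
  have hsum : lagPairing n S R = ∑ j ∈ Finset.Icc (-(n : ℤ)) (n : ℤ), c j :=
    Finset.sum_congr rfl fun j hj => (if_pos hj).symm
  rw [hsum]
  refine sum_nonneg_of_cesaro_nonneg (fun j hj => if_neg hj) fun N => ?_
  have h0 : 0 ≤ ∑ p, ∑ h ∈ Finset.range N, ∑ k ∈ Finset.range N, ∑ a, ∑ b,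
      (if ((k : ℤ) - h) ∈ Finset.Icc (-(n : ℤ)) (n : ℤ) then S ((k : ℤ) - h) a b else 0) *
        (X h a p * X k b p) :=
    Finset.sum_nonneg fun p _ => toeplitz_form_nonneg hS N fun k a => X k a p
  refine h0.trans_eq ?_
  rw [Finset.sum_comm]
  refine Finset.sum_congr rfl fun h _ => ?_
  rw [Finset.sum_comm]
  refine Finset.sum_congr rfl fun k _ => ?_
  by_cases hmem : ((k : ℤ) - h) ∈ Finset.Icc (-(n : ℤ)) (n : ℤ)
  · simp only [c, if_pos hmem]
    rw [Finset.sum_comm]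
    refine Finset.sum_congr rfl fun a _ => ?_
    rw [Finset.sum_comm]
    refine Finset.sum_congr rfl fun b _ => ?_
    rw [← Finset.mul_sum, ← hX h k hmem a b]
    congr 1
    simp [PiLp.inner_apply, mul_comm]
  · simp only [c, if_neg hmem]
    simp

/-- For $\varepsilon$ below the spectrum of the Toeplitz matrix, replacing $R_0$ by $R_0-\varepsilon
I$ keeps it positive definite and lowers the pairing by $\varepsilon\operatorname{tr}S_0$. -/
theorem exists_pos_mul_trace_le_lagPairing {R : ℤ → Matrix (Fin m) (Fin m) ℝ}
    (hR : IsLagSequence R) (hpos : (blockToeplitz n R).PosDef) :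
    ∃ ε : ℝ, 0 < ε ∧ ∀ S : ℤ → Matrix (Fin m) (Fin m) ℝ, PosSemidefOn (symbol n S) →
      ε * (S 0).trace ≤ lagPairing n S R := by
  obtain ⟨ε, hε, hlt⟩ : ∃ ε : ℝ, 0 < ε ∧ ∀ i, ε < hpos.1.eigenvalues i := by
    rcases isEmpty_or_nonempty (Fin (n + 1) × Fin m) with hem | hne
    · exact ⟨1, one_pos, fun i => hem.elim i⟩
    · obtain ⟨i₀, hi₀⟩ := Finite.exists_min hpos.1.eigenvalues
      have := hpos.eigenvalues_pos i₀
      exact ⟨hpos.1.eigenvalues i₀ / 2, by linarith, fun i => by linarith [hi₀ i]⟩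
  refine ⟨ε, hε, fun S hS => ?_⟩
  let R' : ℤ → Matrix (Fin m) (Fin m) ℝ := fun j => R j - if j = 0 then ε • 1 else 0
  have hR' : IsLagSequence R' := by
    intro j
    by_cases hj : j = 0 <;> simp [R', hj, hR j]
    have := hR 0
    simpa using this
  have hT : (blockToeplitz n R').PosDef := by
    have h1 := posDef_sub_smul_one hpos.1 hlt
    have h2 : blockToeplitz n R' = blockToeplitz n R -
        ((ε : ℝ) : ℝ) • (1 : Matrix (Fin (n + 1) × Fin m) (Fin (n + 1) × Fin m) ℝ) := by
      ext p q
      have h3 : (((q.1 : ℕ) : ℤ) - ((p.1 : ℕ) : ℤ) = 0) ↔ p.1 = q.1 := by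
        rw [sub_eq_zero, Nat.cast_inj, Fin.val_inj, eq_comm]
      by_cases h4 : p.1 = q.1 <;> by_cases h5 : p.2 = q.2 <;>
        simp [blockToeplitz, R', h3, h4, h5, Matrix.one_apply, Prod.ext_iff]
    rw [h2]
    exact h1
  have h0 := lagPairing_nonneg hR' hT hS
  have h1 : lagPairing n S R' = lagPairing n S R - ε * (S 0).trace := by
    have h2 : ∀ j a b, S j a b * R' j a b =
        S j a b * R j a b - if j = 0 then (if a = b then ε * S 0 a b else 0) else 0 := by
      intro j a b
      by_cases hj : j = 0 <;> by_cases hab : a = b <;> simp [R', hj, hab]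
      ring
    unfold lagPairing
    simp only [h2, Finset.sum_sub_distrib]
    congr 1
    have h3 : ∀ j : ℤ, (∑ a : Fin m, ∑ b : Fin m,
        if j = 0 then (if a = b then ε * S 0 a b else 0) else 0) =
        if j = 0 then ε * (S 0).trace else 0 := by
      intro j
      split_ifs
      · simp [Matrix.trace, Finset.mul_sum]
      · simp
    simp only [h3]
    simp
  linarith

/-! ### Linear structure, the constant function $I$, and the cost in coefficients -/

theorem symbol_add (S T : ℤ → Matrix (Fin m) (Fin m) ℝ) :
    symbol n (S + T) = symbol n S + symbol n T := by
  funext θ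
  ext a b
  simp [symbol_apply, mul_add, Finset.sum_add_distrib]

theorem symbol_smul (c : ℝ) (S : ℤ → Matrix (Fin m) (Fin m) ℝ) :
    symbol n (c • S) = c • symbol n S := by
  funext θ
  ext a b
  simp [symbol_apply, Finset.mul_sum]
  refine Finset.sum_congr rfl fun j _ => ?_
  ring

theorem lagPairing_add (S T R : ℤ → Matrix (Fin m) (Fin m) ℝ) :
    lagPairing n (S + T) R = lagPairing n S R + lagPairing n T R := by
  simp [lagPairing, add_mul, Finset.sum_add_distrib]

theorem lagPairing_smul (c : ℝ) (S R : ℤ → Matrix (Fin m) (Fin m) ℝ) :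
    lagPairing n (c • S) R = c * lagPairing n S R := by
  simp [lagPairing, Finset.mul_sum, mul_assoc]

/-- The coefficients of the constant function `I`. -/
def identityLag (m : ℕ) : ℤ → Matrix (Fin m) (Fin m) ℝ := fun j => if j = 0 then 1 else 0

theorem isLagSequence_identityLag : IsLagSequence (identityLag m) := by
  intro j
  by_cases hj : j = 0 <;> simp [identityLag, hj]

theorem symbol_identityLag : symbol n (identityLag m) = fun _ => 1 := by
  funext θ
  ext a b
  rw [symbol_apply, Finset.sum_eq_single 0]
  · simp [identityLag, Matrix.one_apply]
    split_ifs <;> simp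
  · intro j _ hj
    simp [identityLag, hj]
  · simp

theorem symbol_add_smul_identityLag (S : ℤ → Matrix (Fin m) (Fin m) ℝ) (t θ : ℝ) :
    symbol n (S + t • identityLag m) θ =
      symbol n S θ + (t : ℂ) • (1 : Matrix (Fin m) (Fin m) ℂ) := by
  rw [symbol_add, symbol_smul, symbol_identityLag]
  rfl

theorem lagPairing_identityLag (R : ℤ → Matrix (Fin m) (Fin m) ℝ) :
    lagPairing n (identityLag m) R = (R 0).trace := by
  unfold lagPairing
  rw [Finset.sum_eq_single 0]
  · simp [identityLag, Matrix.one_apply, Matrix.trace]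
  · intro j _ hj
    simp [identityLag, hj]
  · simp

theorem IsLagSequence.add {S T : ℤ → Matrix (Fin m) (Fin m) ℝ} (hS : IsLagSequence S)
    (hT : IsLagSequence T) : IsLagSequence (S + T) := fun j => by
  simp [hS j, hT j]

theorem IsLagSequence.smul {S : ℤ → Matrix (Fin m) (Fin m) ℝ} (c : ℝ) (hS : IsLagSequence S) :
    IsLagSequence (c • S) := fun j => by
  simp [hS j]

theorem posDefOn_one : PosDefOn (fun _ => 1 : CircleFn m) := fun _ => Matrix.PosDef.one

theorem PosDefOn.posSemidefOn {F : CircleFn m} (h : PosDefOn F) : PosSemidefOn F :=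
  fun θ => (h θ).posSemidef

theorem PosDefOn.symbol_add_smul_identityLag {S : ℤ → Matrix (Fin m) (Fin m) ℝ}
    (h : PosDefOn (symbol n S)) {t : ℝ} (ht : 0 ≤ t) :
    PosDefOn (symbol n (S + t • identityLag m)) := fun θ => by
  rw [ARLatent.symbol_add_smul_identityLag]
  exact (h θ).add_posSemidef (Matrix.PosSemidef.one.smul (by exact_mod_cast ht))

theorem continuous_log_det_symbol {S : ℤ → Matrix (Fin m) (Fin m) ℝ} (h : PosDefOn (symbol n S)) :
    Continuous fun θ => Real.log (symbol n S θ).det.re :=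
  (Complex.continuous_re.comp (continuous_symbol S).matrix_det).log
    fun θ => (PosDef.det_re_pos (h θ)).ne'

theorem entropyCost_symbol {S : ℤ → Matrix (Fin m) (Fin m) ℝ} (h : PosDefOn (symbol n S))
    (R : ℤ → Matrix (Fin m) (Fin m) ℝ) :
    entropyCost (symbol n R) (symbol n S) =
      -mean (fun θ => Real.log (symbol n S θ).det.re) + lagPairing n S R := by
  unfold entropyCost
  rw [mean_add (f := fun θ => -Real.log (symbol n S θ).det.re) (continuous_log_det_symbol h).neg,
    mean_neg, mean_trace_symbol_mul]
  exact Complex.continuous_re.comp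
    ((continuous_symbol S).matrix_mul (continuous_symbol R).matrix_conjTranspose).matrix_trace

/-! ### Coercivity, behaviour near singular functions, and strict convexity -/

theorem mean_eq_of_periodic {f : ℝ → ℝ} (hf : Function.Periodic f (2 * Real.pi)) (θ : ℝ) :
    mean f = (2 * Real.pi)⁻¹ * ∫ x in θ..θ + 2 * Real.pi, f x := by
  unfold mean
  have h := hf.intervalIntegral_add_eq (-Real.pi) θ
  rw [show -Real.pi + 2 * Real.pi = Real.pi by ring] at h
  rw [h]

theorem eq_zero_of_mean_nonpos {f : ℝ → ℝ} (hf : Function.Periodic f (2 * Real.pi))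
    (hc : Continuous f) (h0 : ∀ θ, 0 ≤ f θ) (h : mean f ≤ 0) (θ : ℝ) : f θ = 0 := by
  by_contra hne
  have hpos : 0 < f θ := lt_of_le_of_ne (h0 θ) (Ne.symm hne)
  have hpi := Real.pi_pos
  rw [mean_eq_of_periodic hf θ] at h
  have : 0 < ∫ x in θ..θ + 2 * Real.pi, f x :=
    intervalIntegral.integral_pos (by linarith) hc.continuousOn (fun x _ => h0 x)
      ⟨θ, ⟨le_refl _, by linarith⟩, hpos⟩
  have : 0 < (2 * Real.pi)⁻¹ * ∫ x in θ..θ + 2 * Real.pi, f x := by positivity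
  linarith

theorem le_mean_of_le_on_Icc {f : ℝ → ℝ} (hf : Function.Periodic f (2 * Real.pi))
    (hc : Continuous f) (h0 : ∀ θ, 0 ≤ f θ) {θ u κ : ℝ} (hu : 0 ≤ u) (hu1 : u ≤ 2 * Real.pi)
    (hκ : ∀ s ∈ Set.Icc 0 u, κ ≤ f (θ + s)) : (2 * Real.pi)⁻¹ * (u * κ) ≤ mean f := by
  have hpi := Real.pi_pos
  rw [mean_eq_of_periodic hf θ]
  gcongr
  have hint : ∀ a b, IntervalIntegrable f MeasureTheory.volume a b :=
    fun a b => hc.intervalIntegrable a b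
  rw [← intervalIntegral.integral_add_adjacent_intervals (hint θ (θ + u)) (hint _ _)]
  have h1 : 0 ≤ ∫ x in θ + u..θ + 2 * Real.pi, f x :=
    intervalIntegral.integral_nonneg (by linarith) fun x _ => h0 x
  have h2 : ∫ _x in θ..θ + u, κ ≤ ∫ x in θ..θ + u, f x :=
    intervalIntegral.integral_mono_on (by linarith) (by simp) (hint _ _) fun x hx => by
      have := hκ (x - θ) ⟨by linarith [hx.1], by linarith [hx.2]⟩
      rwa [add_sub_cancel] at this
  rw [intervalIntegral.integral_const, smul_eq_mul] at h2
  have : θ + u - θ = u := by ring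
  rw [this] at h2
  linarith

theorem re_quadForm_le {D : Matrix (Fin m) (Fin m) ℂ} {δ : ℝ} (hD : ∀ a b, ‖D a b‖ ≤ δ)
    {v : Fin m → ℂ} (hv : (star v ⬝ᵥ v).re = 1) : (star v ⬝ᵥ D *ᵥ v).re ≤ m ^ 2 * δ := by
  have hsum : ∑ a, ‖v a‖ ^ 2 = 1 := by
    rw [← hv]
    simp [dotProduct, Complex.normSq_eq_norm_sq, ← Complex.normSq_eq_conj_mul_self]
    norm_cast
  have hle : ∀ a, ‖v a‖ ≤ 1 := fun a => by
    have : ‖v a‖ ^ 2 ≤ 1 := hsum ▸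
      Finset.single_le_sum (f := fun a => ‖v a‖ ^ 2) (fun a _ => sq_nonneg _) (Finset.mem_univ a)
    nlinarith [norm_nonneg (v a)]
  refine (Complex.re_le_norm _).trans ?_
  simp only [dotProduct, Matrix.mulVec, Finset.mul_sum]
  calc _ ≤ ∑ _a : Fin m, ∑ _b : Fin m, δ := by
        refine norm_sum_le_of_le _ fun a _ => norm_sum_le_of_le _ fun b _ => ?_
        rw [norm_mul, norm_mul, Pi.star_apply, norm_star]
        calc ‖v a‖ * (‖D a b‖ * ‖v b‖) ≤ 1 * (δ * 1) := by
              have := norm_nonneg (D a b)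
              gcongr
              · exact hle a
              · exact this.trans (hD a b)
              · exact hD a b
              · exact hle b
          _ = δ := by ring
    _ = m ^ 2 * δ := by simp; ring

/-- Along a bounded family, adding a small multiple of the identity to a function which is close to
being singular decreases the cost. -/
theorem exists_entropyCost_add_lt (R : ℤ → Matrix (Fin m) (Fin m) ℝ) {M : ℝ} (hM0 : 0 ≤ M) :
    ∃ t : ℝ, 0 < t ∧ ∀ S : ℤ → Matrix (Fin m) (Fin m) ℝ, PosDefOn (symbol n S) →
      (∀ j ∈ Finset.Icc (-(n : ℤ)) (n : ℤ), ∀ a b, |S j a b| ≤ M) →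
      (∃ (θ : ℝ) (v : Fin m → ℂ),
        (star v ⬝ᵥ symbol n S θ *ᵥ v).re < t * (star v ⬝ᵥ v).re) →
      entropyCost (symbol n R) (symbol n (S + t • identityLag m)) <
        entropyCost (symbol n R) (symbol n S) := by
  have hpi := Real.pi_gt_three
  set K := |(R 0).trace| with hK
  have hK0 : 0 ≤ K := abs_nonneg _
  set L : ℝ := m ^ 2 * ((2 * n + 1) * n ^ 2 * M) with hL
  have hL0 : 0 ≤ L := by positivity
  -- With $t=u^2$, the mean of $\log\det$ will grow by at least $u/(2\pi(3+L))$ while the linear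
  -- term costs at most $u^2K$. The choice $u=1/D$ makes the former $u^2(K+1)$.
  set D : ℝ := 2 * Real.pi * (3 + L) * (K + 1) with hD
  have hD0 : 18 ≤ D := by
    have h1 : 18 ≤ 2 * Real.pi * (3 + L) := by nlinarith
    nlinarith
  set u : ℝ := 1 / D with hu
  have hu0 : 0 < u := by positivity
  have hu1 : u ≤ 1 := by
    rw [hu, div_le_one (by linarith)]
    linarith
  refine ⟨u ^ 2, by positivity, fun S hS hM ⟨θ₀, v₀, hv₀⟩ => ?_⟩
  set t := u ^ 2 with ht
  have ht0 : 0 < t := by positivity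
  obtain ⟨v, hv, hlt⟩ : ∃ v : Fin m → ℂ, (star v ⬝ᵥ v).re = 1 ∧
      (star v ⬝ᵥ symbol n S θ₀ *ᵥ v).re < t := by
    have hv0 : v₀ ≠ 0 := by
      rintro rfl
      simp at hv₀
    have hpos : 0 < (star v₀ ⬝ᵥ v₀).re := by
      simpa using (Matrix.PosDef.one (n := Fin m) (R := ℂ)).re_dotProduct_pos hv0
    set r := Real.sqrt (star v₀ ⬝ᵥ v₀).re with hr
    have hr0 : 0 < r := Real.sqrt_pos.mpr hpos
    have hr2 : r * r = (star v₀ ⬝ᵥ v₀).re := Real.mul_self_sqrt hpos.le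
    have hscale : ∀ w : Fin m → ℂ, (star (((r⁻¹ : ℝ) : ℂ) • v₀) ⬝ᵥ (((r⁻¹ : ℝ) : ℂ) • w)).re =
        (star v₀ ⬝ᵥ w).re / (r * r) := by
      intro w
      rw [star_smul, smul_dotProduct, dotProduct_smul, Complex.star_def, Complex.conj_ofReal,
        smul_eq_mul, smul_eq_mul, Complex.re_ofReal_mul, Complex.re_ofReal_mul]
      field_simp
    refine ⟨((r⁻¹ : ℝ) : ℂ) • v₀, ?_, ?_⟩
    · rw [hscale, hr2, div_self hpos.ne']
    · rw [Matrix.mulVec_smul, hscale, hr2, div_lt_iff₀ hpos]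
      exact hv₀
  have hS' := hS.symbol_add_smul_identityLag ht0.le
  set f : ℝ → ℝ := fun θ => Real.log (symbol n (S + t • identityLag m) θ).det.re -
    Real.log (symbol n S θ).det.re with hf
  have hfper : Function.Periodic f (2 * Real.pi) := fun θ => by
    simp only [hf, symbol_periodic _ θ]
  have hfc : Continuous f := (continuous_log_det_symbol hS').sub (continuous_log_det_symbol hS)
  have hf0 : ∀ θ, 0 ≤ f θ := fun θ => by
    have := log_det_re_le_add_smul_one (hS θ) ht0
    rw [← symbol_add_smul_identityLag] at this
    simp only [hf]
    linarith
  -- The form $g(\theta)=v^*S(e^{i\theta})v$ is nonnegative at $\theta_0-s$, so the second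
  -- difference bound gives $g(\theta_0+s)\le2g(\theta_0)+Ls^2\le(2+L)t$ for $s\le u=\sqrt t$. No
  -- first derivative enters.
  have hbound : ∀ s ∈ Set.Icc 0 u, 1 / (3 + L) ≤ f (θ₀ + s) := by
    intro s hs
    have hD := re_quadForm_le (v := v)
      (D := symbol n S (θ₀ + s) + symbol n S (θ₀ - s) - (2 : ℂ) • symbol n S θ₀)
      (fun a b => norm_symbol_second_difference_le hM θ₀ s a b) hv
    rw [Matrix.sub_mulVec, Matrix.add_mulVec, Matrix.smul_mulVec, dotProduct_sub, dotProduct_add,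
      dotProduct_smul, Complex.sub_re, Complex.add_re, smul_eq_mul,
      show (2 : ℂ) = ((2 : ℝ) : ℂ) by norm_num, Complex.re_ofReal_mul] at hD
    have hneg : 0 ≤ (star v ⬝ᵥ symbol n S (θ₀ - s) *ᵥ v).re :=
      (hS (θ₀ - s)).posSemidef.re_dotProduct_nonneg v
    have hs2 : s ^ 2 ≤ t := by
      rw [ht]
      exact pow_le_pow_left₀ hs.1 hs.2 2
    have hg : (star v ⬝ᵥ symbol n S (θ₀ + s) *ᵥ v).re ≤ (2 + L) * t := by
      have : (m : ℝ) ^ 2 * ((2 * n + 1) * n ^ 2 * M * s ^ 2) ≤ L * t := by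
        calc _ = L * s ^ 2 := by rw [hL]; ring
          _ ≤ L * t := by gcongr
      nlinarith
    have h := log_det_re_add_le_add_smul_one (hS (θ₀ + s)) ht0 v hv hg
    rw [← symbol_add_smul_identityLag] at h
    have h2 : t / ((2 + L) * t + t) = 1 / (3 + L) := by
      field_simp
      ring
    rw [h2] at h
    simp only [hf]
    linarith
  have hmean := le_mean_of_le_on_Icc hfper hfc hf0 hu0.le (by linarith) hbound
  rw [hf, mean_sub (continuous_log_det_symbol hS') (continuous_log_det_symbol hS)] at hmean
  rw [entropyCost_symbol hS', entropyCost_symbol hS, lagPairing_add, lagPairing_smul,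
    lagPairing_identityLag]
  have hle : (R 0).trace ≤ K := le_abs_self _
  have h1 : t * (R 0).trace ≤ u ^ 2 * K := by
    rw [ht]
    gcongr
  have h2 : (2 * Real.pi)⁻¹ * (u * (1 / (3 + L))) = u ^ 2 * (K + 1) := by
    rw [hu, hD]
    field_simp
  rw [h2] at hmean
  nlinarith

/-- The pairing grows at least like $\varepsilon\operatorname{tr}S_0$, and $\log\det$ can absorb
only half of that, up to a constant. -/
theorem exists_mul_trace_le_entropyCost_add {R : ℤ → Matrix (Fin m) (Fin m) ℝ}
    (hR : IsLagSequence R) (hpos : (blockToeplitz n R).PosDef) :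
    ∃ c C : ℝ, 0 < c ∧ ∀ S : ℤ → Matrix (Fin m) (Fin m) ℝ, PosDefOn (symbol n S) →
      c * (S 0).trace ≤ entropyCost (symbol n R) (symbol n S) + C := by
  obtain ⟨ε, hε, h⟩ := exists_pos_mul_trace_le_lagPairing hR hpos
  refine ⟨ε / 2, -(m * (Real.log (ε / 2) + 1)), by positivity, fun S hS => ?_⟩
  have h1 := h S hS.posSemidefOn
  have h2 : mean (fun θ => Real.log (symbol n S θ).det.re) ≤
      mean fun θ => ε / 2 * (symbol n S θ).trace.re - m * (Real.log (ε / 2) + 1) := by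
    refine mean_mono (continuous_log_det_symbol hS) ?_ fun θ => ?_
    · exact (continuous_const.mul (continuous_trace_symbol S)).sub continuous_const
    · simpa using log_det_re_le_mul_trace (hS θ) (show 0 < ε / 2 by positivity)
  rw [mean_sub (f := fun θ => ε / 2 * (symbol n S θ).trace.re)
    (continuous_const.mul (continuous_trace_symbol S)) continuous_const, mean_const_mul, mean_const,
    mean_trace_symbol] at h2
  rw [entropyCost_symbol hS]
  linarith

/-- On sublevel sets of the cost the trace is bounded, and functions which are not bounded below by
a fixed multiple of the identity can be improved by adding it. -/
theorem exists_uniform_bounds {R : ℤ → Matrix (Fin m) (Fin m) ℝ}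
    (hR : IsLagSequence R) (hpos : (blockToeplitz n R).PosDef) (α : ℝ) :
    ∃ M t : ℝ, 0 < t ∧ ∀ S : ℤ → Matrix (Fin m) (Fin m) ℝ, PosDefOn (symbol n S) →
      entropyCost (symbol n R) (symbol n S) ≤ α →
      (S 0).trace ≤ M ∧
      ((∀ (θ : ℝ) (v : Fin m → ℂ),
          t * (star v ⬝ᵥ v).re ≤ (star v ⬝ᵥ symbol n S θ *ᵥ v).re) ∨
        entropyCost (symbol n R) (symbol n (S + t • identityLag m)) <
          entropyCost (symbol n R) (symbol n S)) := by
  obtain ⟨c, C, hc, h⟩ := exists_mul_trace_le_entropyCost_add hR hpos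
  obtain ⟨t, ht, h2⟩ := exists_entropyCost_add_lt (n := n) R (abs_nonneg ((α + C) / c))
  refine ⟨|(α + C) / c|, t, ht, fun S hS hα => ?_⟩
  have htr : (S 0).trace ≤ |(α + C) / c| := by
    refine le_trans ?_ (le_abs_self _)
    rw [le_div_iff₀ hc]
    linarith [h S hS]
  refine ⟨htr, ?_⟩
  by_contra! hcon
  obtain ⟨hex, hge⟩ := hcon
  exact absurd (h2 S hS (fun j hj a b => (abs_lag_le_trace hS.posSemidefOn hj a b).trans htr) hex)
    (not_lt.mpr hge)

/-- Both functions are compared with the tangent to $\log\det$ at the midpoint $U$, where the linear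
terms cancel. The concavity defect `f` is nonnegative, continuous and of mean at most $0$, so it
vanishes at every angle; the equality case of the tangent inequality then gives $S=U=T$. -/
theorem symbol_eq_of_entropyCost_le_midpoint {R S T : ℤ → Matrix (Fin m) (Fin m) ℝ}
    (hS : PosDefOn (symbol n S)) (hT : PosDefOn (symbol n T))
    (hS2 : entropyCost (symbol n R) (symbol n S) ≤
      entropyCost (symbol n R) (symbol n ((1 / 2 : ℝ) • (S + T))))
    (hT2 : entropyCost (symbol n R) (symbol n T) ≤
      entropyCost (symbol n R) (symbol n ((1 / 2 : ℝ) • (S + T)))) :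
    symbol n S = symbol n T := by
  set U := (1 / 2 : ℝ) • (S + T) with hUdef
  have hUθ : ∀ θ, symbol n S θ + symbol n T θ = (2 : ℂ) • symbol n U θ := fun θ => by
    rw [hUdef, symbol_smul, symbol_add, Pi.smul_apply, Pi.add_apply]
    ext a b
    simp
    ring
  have hU : PosDefOn (symbol n U) := fun θ => by
    rw [hUdef, symbol_smul, symbol_add, Pi.smul_apply, Pi.add_apply]
    exact ((hS θ).add (hT θ)).smul (by norm_num : (0 : ℝ) < 1 / 2)
  have htr : ∀ θ, ((symbol n U θ)⁻¹ * symbol n S θ).trace.re +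
      ((symbol n U θ)⁻¹ * symbol n T θ).trace.re = 2 * m := fun θ => by
    have hu : IsUnit (symbol n U θ).det := (Matrix.isUnit_iff_isUnit_det _).mp (hU θ).isUnit
    rw [← Complex.add_re, ← Matrix.trace_add, ← Matrix.mul_add, hUθ, Matrix.mul_smul,
      Matrix.nonsing_inv_mul _ hu, Matrix.trace_smul, Matrix.trace_one]
    simp
  set f : ℝ → ℝ := fun θ => (2 * Real.log (symbol n U θ).det.re - Real.log (symbol n S θ).det.re) -
    Real.log (symbol n T θ).det.re with hf
  have hc2 : Continuous fun θ => 2 * Real.log (symbol n U θ).det.re :=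
    continuous_const.mul (continuous_log_det_symbol hU)
  have hf0 : ∀ θ, 0 ≤ f θ := fun θ => by
    have h1 := (log_det_re_le (hS θ) (hU θ)).1
    have h2 := (log_det_re_le (hT θ) (hU θ)).1
    have h3 := htr θ
    simp only [hf, Fintype.card_fin] at *
    linarith
  have hfc : Continuous f :=
    (hc2.sub (continuous_log_det_symbol hS)).sub (continuous_log_det_symbol hT)
  have hper : Function.Periodic f (2 * Real.pi) := fun θ => by
    simp only [hf, symbol_periodic _ θ]
  have hmean : mean f ≤ 0 := by
    rw [hf, mean_sub (f := fun θ => 2 * Real.log (symbol n U θ).det.re -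
        Real.log (symbol n S θ).det.re) (hc2.sub (continuous_log_det_symbol hS))
        (continuous_log_det_symbol hT),
      mean_sub hc2 (continuous_log_det_symbol hS), mean_const_mul]
    rw [entropyCost_symbol hS, entropyCost_symbol hU] at hS2
    rw [entropyCost_symbol hT, entropyCost_symbol hU] at hT2
    have hl : 2 * lagPairing n U R = lagPairing n S R + lagPairing n T R := by
      rw [hUdef, lagPairing_smul, lagPairing_add]
      ring
    linarith
  have hzero := eq_zero_of_mean_nonpos hper hfc hf0 hmean
  have hboth : ∀ θ, symbol n S θ = symbol n U θ ∧ symbol n T θ = symbol n U θ := fun θ => by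
    have h1 := log_det_re_le (hS θ) (hU θ)
    have h2 := log_det_re_le (hT θ) (hU θ)
    have h3 := htr θ
    have h4 := hzero θ
    simp only [hf, Fintype.card_fin] at *
    exact ⟨h1.2 (by linarith [h2.1]), h2.2 (by linarith [h1.1])⟩
  funext θ
  rw [(hboth θ).1, (hboth θ).2]

/-! ### Existence of minimizers -/

theorem posDef_of_mul_le_quadForm {A : Matrix (Fin m) (Fin m) ℂ} (hA : A.IsHermitian) {t : ℝ}
    (ht : 0 < t) (h : ∀ v : Fin m → ℂ, t * (star v ⬝ᵥ v).re ≤ (star v ⬝ᵥ A *ᵥ v).re) :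
    A.PosDef := by
  refine Matrix.PosDef.of_dotProduct_mulVec_pos hA fun v hv => ?_
  have h1 : 0 < (star v ⬝ᵥ v).re := by
    simpa using (Matrix.PosDef.one (n := Fin m) (R := ℂ)).re_dotProduct_pos hv
  rw [Complex.pos_iff]
  refine ⟨lt_of_lt_of_le (by positivity) (h v), ?_⟩
  have := hA.im_star_dotProduct_mulVec_self v
  exact this.symm

/-- $W$ parametrizes the pairs $(\Sigma,\Lambda)$ and $A$ their differences. Injectivity of $A$ on
the relevant lags turns bounds on coefficients into bounds on $w$; the element $w_0$ representing
$I$ is the competitor and also the direction in which nearly singular candidates are improved. -/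
theorem exists_entropyCost_minimizer {R : ℤ → Matrix (Fin m) (Fin m) ℝ}
    (hR : IsLagSequence R) (hpos : (blockToeplitz n R).PosDef)
    {W : Type*} [NormedAddCommGroup W] [NormedSpace ℝ W] [FiniteDimensional ℝ W]
    (A : W →ₗ[ℝ] (ℤ → Matrix (Fin m) (Fin m) ℝ)) (hA : ∀ w, IsLagSequence (A w))
    (hinj : ∀ w, (∀ j ∈ Finset.Icc (-(n : ℤ)) (n : ℤ), A w j = 0) → w = 0)
    {C : Set W} (hC : IsClosed C) {w₀ : W} (hw₀C : w₀ ∈ C) (hw₀ : A w₀ = identityLag m)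
    (hadd : ∀ w ∈ C, ∀ t : ℝ, 0 ≤ t → w + t • w₀ ∈ C) :
    ∃ w ∈ C, PosDefOn (symbol n (A w)) ∧ ∀ w' ∈ C, PosDefOn (symbol n (A w')) →
      entropyCost (symbol n R) (symbol n (A w)) ≤ entropyCost (symbol n R) (symbol n (A w')) := by
  have hw₀pos : PosDefOn (symbol n (A w₀)) := by
    rw [hw₀, symbol_identityLag]
    exact posDefOn_one
  obtain ⟨M, t, ht, hMt⟩ := exists_uniform_bounds hR hpos
    (entropyCost (symbol n R) (symbol n (A w₀)))
  have hcA : ∀ j a b, Continuous fun w => A w j a b := fun j a b =>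
    ((Matrix.entryLinearMap ℝ ℝ a b).comp
      ((LinearMap.proj j).comp A)).continuous_of_finiteDimensional
  have hcF : Continuous fun p : W × ℝ => symbol n (A p.1) p.2 := by
    refine continuous_pi fun a => continuous_pi fun b => ?_
    simp only [symbol_apply]
    have : ∀ j a b, Continuous fun p : W × ℝ => A p.1 j a b :=
      fun j a b => (hcA j a b).comp continuous_fst
    fun_prop
  have hcFθ : ∀ θ, Continuous fun w => symbol n (A w) θ := fun θ =>
    hcF.comp (continuous_id.prodMk continuous_const)
  have hctr : Continuous fun w => (A w 0).trace := by
    simp only [Matrix.trace, Matrix.diag_apply]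
    exact continuous_finsetSum _ fun a _ => hcA 0 a a
  -- The term $tm$ leaves room for the trace added by $tI$, so improved candidates still lie in `K`.
  set B : ℝ := M + t * m with hB
  let K : Set W := {w | w ∈ C ∧ (∀ (θ : ℝ) (v : Fin m → ℂ),
    t * (star v ⬝ᵥ v).re ≤ (star v ⬝ᵥ symbol n (A w) θ *ᵥ v).re) ∧ (A w 0).trace ≤ B}
  have hKpos : ∀ w ∈ K, PosDefOn (symbol n (A w)) := fun w hw θ =>
    posDef_of_mul_le_quadForm (symbol_isHermitian (hA w) θ) ht (hw.2.1 θ)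
  have hKclosed : IsClosed K := by
    have hK : K = C ∩ ((⋂ (θ : ℝ), ⋂ (v : Fin m → ℂ),
        {w | t * (star v ⬝ᵥ v).re ≤ (star v ⬝ᵥ symbol n (A w) θ *ᵥ v).re}) ∩
        {w | (A w 0).trace ≤ B}) := by
      ext w
      simp only [K, Set.mem_inter_iff, Set.mem_iInter]
      rfl
    rw [hK]
    refine hC.inter (IsClosed.inter ?_ (isClosed_le hctr continuous_const))
    refine isClosed_iInter fun θ => isClosed_iInter fun v => isClosed_le continuous_const ?_
    exact Complex.continuous_re.comp
      (continuous_const.dotProduct ((hcFθ θ).matrix_mulVec continuous_const))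
  let T : W →ₗ[ℝ] (Finset.Icc (-(n : ℤ)) (n : ℤ) → Fin m → Fin m → ℝ) :=
    LinearMap.pi fun j => LinearMap.pi fun a => LinearMap.pi fun b =>
      (Matrix.entryLinearMap ℝ ℝ a b).comp ((LinearMap.proj (j : ℤ)).comp A)
  have hT : ∀ w j a b, T w j a b = A w j a b := fun _ _ _ _ => rfl
  have hTker : LinearMap.ker T = ⊥ := by
    refine (Submodule.eq_bot_iff _).mpr fun w hw => hinj w fun j hj => ?_
    ext a b
    have := congrFun (congrFun (congrFun (LinearMap.mem_ker.mp hw) ⟨j, hj⟩) a) b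
    rwa [hT] at this
  have hKcompact : IsCompact K := by
    refine IsCompact.of_isClosed_subset
      ((LinearMap.isClosedEmbedding_of_injective hTker).isCompact_preimage
        (isCompact_closedBall 0 |B|)) hKclosed fun w hw => ?_
    rw [Set.mem_preimage, mem_closedBall_zero_iff]
    refine (pi_norm_le_iff_of_nonneg (abs_nonneg _)).mpr fun j =>
      (pi_norm_le_iff_of_nonneg (abs_nonneg _)).mpr fun a =>
      (pi_norm_le_iff_of_nonneg (abs_nonneg _)).mpr fun b => ?_
    rw [hT, Real.norm_eq_abs]
    exact ((abs_lag_le_trace (hKpos w hw).posSemidefOn j.2 a b).trans hw.2.2).trans (le_abs_self _)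
  have hcost : ContinuousOn (fun w => entropyCost (symbol n R) (symbol n (A w))) K := by
    rw [continuousOn_iff_continuous_domRestrict]
    have heq : K.domRestrict (fun w => entropyCost (symbol n R) (symbol n (A w))) = fun w : K =>
        -mean (fun θ => Real.log (symbol n (A w) θ).det.re) + lagPairing n (A w) R :=
      funext fun w => entropyCost_symbol (hKpos w w.2) R
    rw [heq]
    refine Continuous.add (Continuous.neg ?_) ?_
    · refine continuous_const.mul ?_
      refine intervalIntegral.continuous_parametric_intervalIntegral_of_continuous' ?_ _ _
      refine Continuous.log ?_ fun p => (PosDef.det_re_pos (hKpos p.1 p.1.2 p.2)).ne'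
      exact Complex.continuous_re.comp (hcF.comp
        ((continuous_subtype_val.comp continuous_fst).prodMk continuous_snd)).matrix_det
    · unfold lagPairing
      refine continuous_finsetSum _ fun j _ => continuous_finsetSum _ fun a _ =>
        continuous_finsetSum _ fun b _ => ?_
      exact ((hcA j a b).comp continuous_subtype_val).mul continuous_const
  have himprove : ∀ w ∈ C, PosDefOn (symbol n (A w)) →
      entropyCost (symbol n R) (symbol n (A w)) ≤ entropyCost (symbol n R) (symbol n (A w₀)) →
      ∃ w' ∈ K, entropyCost (symbol n R) (symbol n (A w')) ≤
        entropyCost (symbol n R) (symbol n (A w)) := by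
    intro w hw hwpos hle
    obtain ⟨htr, h⟩ := hMt (A w) hwpos hle
    have htm : 0 ≤ t * m := by positivity
    rcases h with h | h
    · exact ⟨w, ⟨hw, h, by linarith⟩, le_rfl⟩
    · have hAw : A (w + t • w₀) = A w + t • identityLag m := by
        rw [map_add, map_smul, hw₀]
      refine ⟨w + t • w₀, ⟨hadd w hw t ht.le, fun θ v => ?_, ?_⟩, ?_⟩
      · rw [hAw, symbol_add_smul_identityLag, Matrix.add_mulVec, Matrix.smul_mulVec,
          Matrix.one_mulVec, dotProduct_add, dotProduct_smul, Complex.add_re, smul_eq_mul,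
          Complex.re_ofReal_mul]
        have := (hwpos θ).posSemidef.re_dotProduct_nonneg v
        simp only [RCLike.re_to_complex] at this
        linarith
      · rw [hAw]
        simp [identityLag]
        linarith
      · rw [hAw]
        exact h.le
  obtain ⟨w₁, hw₁K, _⟩ := himprove w₀ hw₀C hw₀pos le_rfl
  obtain ⟨w, hwK, hmin⟩ := hKcompact.exists_isMinOn ⟨w₁, hw₁K⟩ hcost
  have hle : ∀ w' ∈ C, PosDefOn (symbol n (A w')) →
      entropyCost (symbol n R) (symbol n (A w')) ≤ entropyCost (symbol n R) (symbol n (A w₀)) →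
      entropyCost (symbol n R) (symbol n (A w)) ≤ entropyCost (symbol n R) (symbol n (A w')) := by
    intro w' hw' hpos' hle'
    obtain ⟨w'', hw'', h⟩ := himprove w' hw' hpos' hle'
    exact (hmin hw'').trans h
  refine ⟨w, hwK.1, hKpos w hwK, fun w' hw' hpos' => ?_⟩
  rcases le_total (entropyCost (symbol n R) (symbol n (A w')))
    (entropyCost (symbol n R) (symbol n (A w₀))) with h | h
  · exact hle w' hw' hpos' h
  · exact (hle w₀ hw₀C hw₀pos le_rfl).trans h

/-! ### The subspaces $\mathcal V_E$ and $\mathcal V_G$ in finite-dimensional coordinates -/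

theorem symbol_congr {S T : ℤ → Matrix (Fin m) (Fin m) ℝ}
    (h : ∀ j ∈ Finset.Icc (-(n : ℤ)) (n : ℤ), S j = T j) : symbol n S = symbol n T :=
  funext fun _ => Finset.sum_congr rfl fun j hj => by rw [h j hj]

theorem symbol_sub (S T : ℤ → Matrix (Fin m) (Fin m) ℝ) :
    symbol n (S - T) = symbol n S - symbol n T := by
  have h : S - T = S + (-1 : ℝ) • T := by rw [neg_one_smul, sub_eq_add_neg]
  rw [h, symbol_add, symbol_smul, neg_one_smul, sub_eq_add_neg]

theorem symbol_zero : symbol n (0 : ℤ → Matrix (Fin m) (Fin m) ℝ) = 0 := by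
  simpa using symbol_smul (n := n) 0 (0 : ℤ → Matrix (Fin m) (Fin m) ℝ)

theorem IsLagSequence.sub {S T : ℤ → Matrix (Fin m) (Fin m) ℝ} (hS : IsLagSequence S)
    (hT : IsLagSequence T) : IsLagSequence (S - T) := fun j => by
  simp [hS j, hT j]

theorem isLagSequence_zero : IsLagSequence (0 : ℤ → Matrix (Fin m) (Fin m) ℝ) := fun j => by simp

theorem lagPairing_sub (S T R : ℤ → Matrix (Fin m) (Fin m) ℝ) :
    lagPairing n (S - T) R = lagPairing n S R - lagPairing n T R := by
  simp [lagPairing, sub_mul, Finset.sum_sub_distrib]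

theorem pseudoPoly_add {F F' : CircleFn m} (hF : F ∈ pseudoPoly m n) (hF' : F' ∈ pseudoPoly m n) :
    F + F' ∈ pseudoPoly m n := by
  obtain ⟨S, hS, rfl⟩ := hF
  obtain ⟨T, hT, rfl⟩ := hF'
  exact ⟨S + T, hS.add hT, (symbol_add S T).symm⟩

theorem pseudoPoly_smul (c : ℝ) {F : CircleFn m} (hF : F ∈ pseudoPoly m n) :
    c • F ∈ pseudoPoly m n := by
  obtain ⟨S, hS, rfl⟩ := hF
  exact ⟨c • S, hS.smul c, (symbol_smul c S).symm⟩

theorem zero_mem_pseudoPoly : (0 : CircleFn m) ∈ pseudoPoly m n :=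
  ⟨0, isLagSequence_zero, symbol_zero.symm⟩

theorem sparseSpace_add {E : Set (Fin m × Fin m)} {F F' : CircleFn m} (hF : F ∈ sparseSpace n E)
    (hF' : F' ∈ sparseSpace n E) : F + F' ∈ sparseSpace n E :=
  ⟨pseudoPoly_add hF.1 hF'.1, fun k h hkh θ => by
    simp [hF.2 k h hkh θ, hF'.2 k h hkh θ]⟩

theorem sparseSpace_smul {E : Set (Fin m × Fin m)} (c : ℝ) {F : CircleFn m}
    (hF : F ∈ sparseSpace n E) : c • F ∈ sparseSpace n E :=
  ⟨pseudoPoly_smul c hF.1, fun k h hkh θ => by simp [hF.2 k h hkh θ]⟩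

theorem zero_mem_sparseSpace (E : Set (Fin m × Fin m)) : (0 : CircleFn m) ∈ sparseSpace n E :=
  ⟨zero_mem_pseudoPoly, fun _ _ _ _ => rfl⟩

theorem shiftQuad_add (X Y : Matrix (Fin (n + 1) × Fin m) (Fin (n + 1) × Fin m) ℝ) :
    shiftQuad (X + Y) = shiftQuad X + shiftQuad Y := by
  funext θ
  simp [shiftQuad, Matrix.map_add, Matrix.mul_add, Matrix.add_mul]

theorem shiftQuad_smul (c : ℝ) (X : Matrix (Fin (n + 1) × Fin m) (Fin (n + 1) × Fin m) ℝ) :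
    shiftQuad (c • X) = c • shiftQuad X := by
  funext θ
  have : (c • X).map Complex.ofReal = (c : ℂ) • X.map Complex.ofReal := by
    ext p q
    simp
  rw [Pi.smul_apply, shiftQuad, this, Matrix.mul_smul, Matrix.smul_mul]
  rfl

theorem shiftQuad_zero :
    shiftQuad (0 : Matrix (Fin (n + 1) × Fin m) (Fin (n + 1) × Fin m) ℝ) = 0 := by
  simpa using shiftQuad_smul (m := m) (n := n) 0 0

theorem lowRankSpace_add {l : ℕ} {G : Matrix (Fin l) (Fin (n + 1) × Fin m) ℝ} {F F' : CircleFn m}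
    (hF : F ∈ lowRankSpace G) (hF' : F' ∈ lowRankSpace G) : F + F' ∈ lowRankSpace G := by
  obtain ⟨H, hH, rfl⟩ := hF
  obtain ⟨H', hH', rfl⟩ := hF'
  exact ⟨H + H', hH.add hH', by rw [Matrix.mul_add, Matrix.add_mul, shiftQuad_add]⟩

theorem lowRankSpace_smul {l : ℕ} {G : Matrix (Fin l) (Fin (n + 1) × Fin m) ℝ} (c : ℝ)
    {F : CircleFn m} (hF : F ∈ lowRankSpace G) : c • F ∈ lowRankSpace G := by
  obtain ⟨H, hH, rfl⟩ := hF
  exact ⟨c • H, hH.smul c, by rw [Matrix.mul_smul, Matrix.smul_mul, shiftQuad_smul]⟩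

theorem zero_mem_lowRankSpace {l : ℕ} (G : Matrix (Fin l) (Fin (n + 1) × Fin m) ℝ) :
    (0 : CircleFn m) ∈ lowRankSpace G := by
  refine ⟨0, Matrix.isSymm_zero, ?_⟩
  rw [Matrix.mul_zero, Matrix.zero_mul, shiftQuad_zero]

/-- Extension by zero of a family of coefficients indexed by `-n, …, n`. -/
noncomputable def extendLag (m n : ℕ) : (Finset.Icc (-(n : ℤ)) (n : ℤ) → Fin m → Fin m → ℝ) →ₗ[ℝ]
    (ℤ → Matrix (Fin m) (Fin m) ℝ) where
  toFun s j := if h : j ∈ Finset.Icc (-(n : ℤ)) (n : ℤ) then Matrix.of (s ⟨j, h⟩) else 0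
  map_add' s t := by
    funext j
    by_cases h : j ∈ Finset.Icc (-(n : ℤ)) (n : ℤ)
    · simp only [Pi.add_apply, dif_pos h]
      rfl
    · simp only [Pi.add_apply, dif_neg h, add_zero]
  map_smul' c s := by
    funext j
    by_cases h : j ∈ Finset.Icc (-(n : ℤ)) (n : ℤ)
    · simp only [Pi.smul_apply, dif_pos h]
      rfl
    · simp only [Pi.smul_apply, dif_neg h, smul_zero]

theorem extendLag_apply_of_mem (s : Finset.Icc (-(n : ℤ)) (n : ℤ) → Fin m → Fin m → ℝ) {j : ℤ}
    (hj : j ∈ Finset.Icc (-(n : ℤ)) (n : ℤ)) : extendLag m n s j = Matrix.of (s ⟨j, hj⟩) :=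
  dif_pos hj

theorem extendLag_apply_of_notMem (s : Finset.Icc (-(n : ℤ)) (n : ℤ) → Fin m → Fin m → ℝ) {j : ℤ}
    (hj : j ∉ Finset.Icc (-(n : ℤ)) (n : ℤ)) : extendLag m n s j = 0 :=
  dif_neg hj

/-- Lags beyond $n$ do not affect the function, so truncation loses nothing and provides a
finite-dimensional parameter space. -/
theorem exists_symbol_extendLag {F : CircleFn m} (hF : F ∈ pseudoPoly m n) :
    ∃ s, IsLagSequence (extendLag m n s) ∧ symbol n (extendLag m n s) = F := by
  obtain ⟨S, hS, rfl⟩ := hF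
  refine ⟨fun j a b => S j a b, fun j => ?_, symbol_congr fun j hj => extendLag_apply_of_mem _ hj⟩
  by_cases hj : j ∈ Finset.Icc (-(n : ℤ)) (n : ℤ)
  · have hj' : -j ∈ Finset.Icc (-(n : ℤ)) (n : ℤ) := by
      rw [Finset.mem_Icc] at hj ⊢
      omega
    rw [extendLag_apply_of_mem _ hj, extendLag_apply_of_mem _ hj']
    exact hS j
  · have hj' : -j ∉ Finset.Icc (-(n : ℤ)) (n : ℤ) := by
      rw [Finset.mem_Icc] at hj ⊢
      omega
    rw [extendLag_apply_of_notMem _ hj, extendLag_apply_of_notMem _ hj', Matrix.transpose_zero]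

/-- The coefficients of the pairs in `V_E × V_G`. -/
noncomputable def structuredCoeff {l : ℕ} (E : Set (Fin m × Fin m))
    (G : Matrix (Fin l) (Fin (n + 1) × Fin m) ℝ) :
    Submodule ℝ ((Finset.Icc (-(n : ℤ)) (n : ℤ) → Fin m → Fin m → ℝ) ×
      (Finset.Icc (-(n : ℤ)) (n : ℤ) → Fin m → Fin m → ℝ)) where
  carrier := {p | IsLagSequence (extendLag m n p.1) ∧ IsLagSequence (extendLag m n p.2) ∧
    symbol n (extendLag m n p.1) ∈ sparseSpace n E ∧ symbol n (extendLag m n p.2) ∈ lowRankSpace G}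
  add_mem' {p q} hp hq := by
    simp only [Set.mem_ofPred_eq, Prod.fst_add, Prod.snd_add, map_add, symbol_add] at *
    exact ⟨hp.1.add hq.1, hp.2.1.add hq.2.1, sparseSpace_add hp.2.2.1 hq.2.2.1,
      lowRankSpace_add hp.2.2.2 hq.2.2.2⟩
  zero_mem' := by
    simp only [Set.mem_ofPred_eq, Prod.fst_zero, Prod.snd_zero, map_zero, symbol_zero]
    exact ⟨isLagSequence_zero, isLagSequence_zero, zero_mem_sparseSpace E, zero_mem_lowRankSpace G⟩
  smul_mem' c p hp := by
    simp only [Set.mem_ofPred_eq, Prod.smul_fst, Prod.smul_snd, map_smul, symbol_smul] at *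
    exact ⟨hp.1.smul c, hp.2.1.smul c, sparseSpace_smul c hp.2.2.1, lowRankSpace_smul c hp.2.2.2⟩

/-! ### Unique solvability of the identification problem -/

theorem decomposition_unique {l : ℕ} {E : Set (Fin m × Fin m)}
    {G : Matrix (Fin l) (Fin (n + 1) × Fin m) ℝ} (hEG : sparseSpace n E ∩ lowRankSpace G = {0})
    {S L S' L' : CircleFn m} (hS : S ∈ sparseSpace n E) (hL : L ∈ lowRankSpace G)
    (hS' : S' ∈ sparseSpace n E) (hL' : L' ∈ lowRankSpace G) (h : S' - L' = S - L) :
    S' = S ∧ L' = L := by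
  have h1 : S' + (-1 : ℝ) • S = L' + (-1 : ℝ) • L := by
    rw [neg_one_smul, neg_one_smul, ← sub_eq_add_neg, ← sub_eq_add_neg, sub_eq_sub_iff_sub_eq_sub]
    exact h
  have h2 : S' + (-1 : ℝ) • S ∈ sparseSpace n E ∩ lowRankSpace G :=
    ⟨sparseSpace_add hS' (sparseSpace_smul _ hS),
      h1 ▸ lowRankSpace_add hL' (lowRankSpace_smul _ hL)⟩
  rw [hEG, Set.mem_singleton_iff] at h2
  have h3 := h1.symm.trans h2
  rw [neg_one_smul, ← sub_eq_add_neg, sub_eq_zero] at h2 h3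
  exact ⟨h2, h3⟩

theorem posSemidef_iff_re_nonneg {A : Matrix (Fin m) (Fin m) ℂ} (hA : A.IsHermitian) :
    A.PosSemidef ↔ ∀ v : Fin m → ℂ, 0 ≤ (star v ⬝ᵥ A *ᵥ v).re := by
  refine ⟨fun h v => h.re_dotProduct_nonneg v, fun h => ?_⟩
  refine Matrix.PosSemidef.of_dotProduct_mulVec_nonneg hA fun v => ?_
  rw [Complex.nonneg_iff]
  exact ⟨h v, (hA.im_star_dotProduct_mulVec_self v).symm⟩

theorem isClosed_setOf_posSemidefOn {W : Type*} [NormedAddCommGroup W] [NormedSpace ℝ W]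
    [FiniteDimensional ℝ W] (A : W →ₗ[ℝ] (ℤ → Matrix (Fin m) (Fin m) ℝ))
    (hA : ∀ w, IsLagSequence (A w)) : IsClosed {w | PosSemidefOn (symbol n (A w))} := by
  have heq : {w | PosSemidefOn (symbol n (A w))} = ⋂ (θ : ℝ), ⋂ (v : Fin m → ℂ),
      {w | 0 ≤ (star v ⬝ᵥ symbol n (A w) θ *ᵥ v).re} := by
    ext w
    simp only [Set.mem_iInter]
    exact forall_congr' fun θ => posSemidef_iff_re_nonneg (symbol_isHermitian (hA w) θ)
  rw [heq]
  refine isClosed_iInter fun θ => isClosed_iInter fun v => isClosed_le continuous_const ?_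
  have hcA : ∀ j a b, Continuous fun w => A w j a b := fun j a b =>
    ((Matrix.entryLinearMap ℝ ℝ a b).comp
      ((LinearMap.proj j).comp A)).continuous_of_finiteDimensional
  have hcF : Continuous fun w => symbol n (A w) θ := by
    refine continuous_pi fun a => continuous_pi fun b => ?_
    simp only [symbol_apply]
    fun_prop
  exact Complex.continuous_re.comp (continuous_const.dotProduct (hcF.matrix_mulVec continuous_const))

/-- The trivial intersection serves twice: it makes the difference map injective, as existence
requires, and it recovers the pair from the unique optimal difference. The diagonal condition on $E$
places $(I,0)$ among the feasible pairs. -/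
theorem hasUniqueModel_of_inter_eq {R : ℤ → Matrix (Fin m) (Fin m) ℝ}
    (hR : IsLagSequence R) (hpos : (blockToeplitz n R).PosDef) {l : ℕ} {E : Set (Fin m × Fin m)}
    {G : Matrix (Fin l) (Fin (n + 1) × Fin m) ℝ} (hE : ∀ k, (k, k) ∈ E)
    (hEG : sparseSpace n E ∩ lowRankSpace G = {0}) : HasUniqueModel R E G := by
  let W := structuredCoeff (n := n) E G
  let B : W →ₗ[ℝ] (ℤ → Matrix (Fin m) (Fin m) ℝ) :=
    (extendLag m n).comp ((LinearMap.snd ℝ _ _).comp W.subtype)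
  let A : W →ₗ[ℝ] (ℤ → Matrix (Fin m) (Fin m) ℝ) :=
    (extendLag m n).comp ((LinearMap.fst ℝ _ _).comp W.subtype) - B
  have hAapp : ∀ w : W, A w = extendLag m n w.1.1 - extendLag m n w.1.2 := fun _ => rfl
  have hBapp : ∀ w : W, B w = extendLag m n w.1.2 := fun _ => rfl
  have hsymA : ∀ w : W, symbol n (A w) =
      symbol n (extendLag m n w.1.1) - symbol n (extendLag m n w.1.2) := fun w => by
    rw [hAapp, symbol_sub]
  have hext0 : ∀ s, symbol n (extendLag m n s) = 0 → s = 0 := by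
    intro s hs
    funext j
    have h := eq_zero_of_symbol_eq_zero hs j.2
    rw [extendLag_apply_of_mem _ j.2] at h
    exact h
  have hinj : ∀ w, (∀ j ∈ Finset.Icc (-(n : ℤ)) (n : ℤ), A w j = 0) → w = 0 := by
    intro w hw
    have h1 : symbol n (A w) = 0 := by
      rw [symbol_congr (T := 0) hw, symbol_zero]
    rw [hsymA] at h1
    obtain ⟨h2, h3⟩ := decomposition_unique hEG (zero_mem_sparseSpace E) (zero_mem_lowRankSpace G)
      w.2.2.2.1 w.2.2.2.2 (h1.trans (sub_zero _).symm)
    exact Subtype.ext (Prod.ext (hext0 _ h2) (hext0 _ h3))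
  have hone : symbol n (identityLag m) ∈ sparseSpace n E := by
    refine ⟨⟨_, isLagSequence_identityLag, rfl⟩, fun k h hkh θ => ?_⟩
    rw [symbol_identityLag]
    refine Matrix.one_apply_ne ?_
    rintro rfl
    exact hkh (hE k)
  let e : Finset.Icc (-(n : ℤ)) (n : ℤ) → Fin m → Fin m → ℝ := fun j => identityLag m j
  have he : extendLag m n e = identityLag m := by
    funext j
    by_cases hj : j ∈ Finset.Icc (-(n : ℤ)) (n : ℤ)
    · rw [extendLag_apply_of_mem _ hj]
      rfl
    · rw [extendLag_apply_of_notMem _ hj, identityLag, if_neg]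
      rintro rfl
      simp at hj
  have hemem : ((e, 0) : _ × _) ∈ W := by
    refine ⟨?_, ?_, ?_, ?_⟩
    · simp only [he]; exact isLagSequence_identityLag
    · simp only [map_zero]; exact isLagSequence_zero
    · simp only [he]; exact hone
    · simp only [map_zero, symbol_zero]; exact zero_mem_lowRankSpace G
  obtain ⟨w, hwC, hwpos, hmin⟩ := exists_entropyCost_minimizer hR hpos A
    (fun w => w.2.1.sub w.2.2.1) hinj
    (C := {w | PosSemidefOn (symbol n (B w))})
    (isClosed_setOf_posSemidefOn B fun w => w.2.2.1) (w₀ := ⟨(e, 0), hemem⟩)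
    (by
      intro θ
      rw [hBapp]
      simp only [map_zero, symbol_zero]
      exact Matrix.PosSemidef.zero)
    (by rw [hAapp]; simp only [he, map_zero, sub_zero])
    (by
      intro w hw t _ θ
      have : B (w + t • ⟨(e, 0), hemem⟩) = B w := by
        rw [map_add, map_smul, hBapp ⟨(e, 0), hemem⟩]
        simp
      rw [this]
      exact hw θ)
  have hsol : IsARSolution R E G
      (symbol n (extendLag m n w.1.1), symbol n (extendLag m n w.1.2)) := by
    refine ⟨⟨⟨_, w.2.1, rfl⟩, ⟨_, w.2.2.1, rfl⟩, ?_, hwC, w.2.2.2.1, w.2.2.2.2⟩, ?_⟩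
    · simp only [← hsymA]
      exact hwpos
    · intro q hq
      obtain ⟨s, hs, hsq⟩ := exists_symbol_extendLag hq.1
      obtain ⟨r, hr, hrq⟩ := exists_symbol_extendLag hq.2.1
      have hmem : ((s, r) : _ × _) ∈ W :=
        ⟨hs, hr, by simp only [hsq]; exact hq.2.2.2.2.1, by simp only [hrq]; exact hq.2.2.2.2.2⟩
      have hq' : symbol n (A ⟨(s, r), hmem⟩) = q.1 - q.2 := by
        rw [hsymA]
        simp only [hsq, hrq]
      have h := hmin ⟨(s, r), hmem⟩
        (by
          simp only [Set.mem_ofPred_eq, hBapp, hrq]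
          exact hq.2.2.2.1)
        (by rw [hq']; exact hq.2.2.1)
      rw [hq', hsymA] at h
      exact h
  refine ⟨_, _, hsol, fun S' L' hsol' => ?_, fun S' L' hS' hL' h =>
    decomposition_unique hEG w.2.2.2.1 w.2.2.2.2 hS' hL' h⟩
  generalize hS : symbol n (extendLag m n w.1.1) = S at *
  generalize hL : symbol n (extendLag m n w.1.2) = L at *
  obtain ⟨⟨hSQ, hLQ, hSLpos, hLpos, hSE, hLG⟩, hmin1⟩ := hsol
  obtain ⟨⟨hSQ', hLQ', hSLpos', hLpos', hSE', hLG'⟩, hmin2⟩ := hsol'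
  refine decomposition_unique hEG hSE hLG hSE' hLG' ?_
  obtain ⟨s, -, rfl⟩ := id hSQ
  obtain ⟨r, -, rfl⟩ := id hLQ
  obtain ⟨s', -, rfl⟩ := id hSQ'
  obtain ⟨r', -, rfl⟩ := id hLQ'
  -- The midpoint of two solutions is feasible, so neither costs more than it and strict convexity
  -- makes the differences coincide.
  have hmid : symbol n ((1 / 2 : ℝ) • ((s - r) + (s' - r'))) =
      (1 / 2 : ℝ) • (symbol n s + symbol n s') - (1 / 2 : ℝ) • (symbol n r + symbol n r') := by
    rw [← smul_sub, ← symbol_add, ← symbol_add, ← symbol_sub, ← symbol_smul]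
    congr 2
    abel
  have hfeas : ((1 / 2 : ℝ) • (symbol n s + symbol n s'), (1 / 2 : ℝ) • (symbol n r + symbol n r')) ∈
      arFeasible E G := by
    refine ⟨pseudoPoly_smul _ (pseudoPoly_add hSQ hSQ'), pseudoPoly_smul _ (pseudoPoly_add hLQ hLQ'),
      ?_, fun θ => ?_, sparseSpace_smul _ (sparseSpace_add hSE hSE'),
      lowRankSpace_smul _ (lowRankSpace_add hLG hLG')⟩
    · simp only [← hmid]
      intro θ
      rw [symbol_smul, symbol_add, symbol_sub, symbol_sub]
      exact ((hSLpos θ).add (hSLpos' θ)).smul (by norm_num : (0 : ℝ) < 1 / 2)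
    · exact ((hLpos θ).add (hLpos' θ)).smul (by norm_num : (0 : ℝ) ≤ 1 / 2)
  have h1 := hmin1 hfeas
  have h2 := hmin2 hfeas
  simp only [Set.mem_ofPred_eq, ← hmid, ← symbol_sub] at h1 h2
  rw [← symbol_sub, ← symbol_sub]
  rw [← symbol_sub] at hSLpos hSLpos'
  exact (symbol_eq_of_entropyCost_le_midpoint hSLpos hSLpos' h1 h2).symm

/-- $\Sigma=(\Sigma-\Lambda)+\Lambda$ is positive definite, so its diagonal entries are nonzero at
any angle. -/
theorem diag_mem_of_isEstimate {R : ℤ → Matrix (Fin m) (Fin m) ℝ} {lam gam : ℝ} {l : ℕ}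
    {E : Set (Fin m × Fin m)} {G : Matrix (Fin l) (Fin (n + 1) × Fin m) ℝ}
    (h : IsEstimate R lam gam E G) (k : Fin m) : (k, k) ∈ E := by
  obtain ⟨S, L, ⟨⟨_, _, hpos, hL⟩, _⟩, rfl, _, _⟩ := h
  refine ⟨0, ?_⟩
  have h := (hpos 0).add_posSemidef (hL 0)
  have h2 : (S - L) 0 + L 0 = S 0 := by simp
  simp only [h2] at h
  exact (h.diag_pos (i := k)).ne'

/-! ### The two penalties as bounds on coefficients -/

theorem lowRankPenalty_of_posSemidefOn {F : CircleFn m} (hF : PosSemidefOn F) :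
    lowRankPenalty F = mean fun θ => (F θ).trace.re := by
  unfold lowRankPenalty
  congr 1
  funext θ
  exact sumSingularValues_of_posSemidef (hF θ)

theorem lowRankPenalty_symbol {S : ℤ → Matrix (Fin m) (Fin m) ℝ} (hS : PosSemidefOn (symbol n S)) :
    lowRankPenalty (symbol n S) = (S 0).trace := by
  rw [lowRankPenalty_of_posSemidefOn hS, mean_trace_symbol]

theorem sparsityPenalty_term_nonneg (F : CircleFn m) (k h : Fin m) :
    0 ≤ if h < k then
      ⨆ j : Fin (n + 1), max ‖oneSided F (j : ℕ) k h‖ ‖oneSided F (j : ℕ) h k‖ else 0 := by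
  split_ifs
  · exact Real.iSup_nonneg fun j => le_max_of_le_left (norm_nonneg _)
  · exact le_rfl

theorem sparsityPenalty_nonneg (F : CircleFn m) : 0 ≤ sparsityPenalty n F :=
  Finset.sum_nonneg fun k _ => Finset.sum_nonneg fun h _ => sparsityPenalty_term_nonneg F k h

theorem max_norm_oneSided_le_sparsityPenalty (F : CircleFn m) {k h : Fin m} (hkh : h < k)
    (j : Fin (n + 1)) :
    max ‖oneSided F (j : ℕ) k h‖ ‖oneSided F (j : ℕ) h k‖ ≤ sparsityPenalty n F := by
  have h1 := le_ciSup (f := fun j : Fin (n + 1) =>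
    max ‖oneSided F (j : ℕ) k h‖ ‖oneSided F (j : ℕ) h k‖) (Set.finite_range _).bddAbove j
  refine h1.trans ?_
  have h2 := Finset.single_le_sum (f := fun h : Fin m => if h < k then
      ⨆ j : Fin (n + 1), max ‖oneSided F (j : ℕ) k h‖ ‖oneSided F (j : ℕ) h k‖ else 0)
    (fun h _ => sparsityPenalty_term_nonneg F k h) (Finset.mem_univ h)
  simp only [if_pos hkh] at h2
  refine h2.trans ?_
  exact Finset.single_le_sum (f := fun k : Fin m => ∑ h : Fin m, if h < k then
      ⨆ j : Fin (n + 1), max ‖oneSided F (j : ℕ) k h‖ ‖oneSided F (j : ℕ) h k‖ else 0)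
    (fun k _ => Finset.sum_nonneg fun h _ => sparsityPenalty_term_nonneg F k h) (Finset.mem_univ k)

/-- Negative lags are transposes of positive ones, and the maximum in $\phi_1$ covers both $(k,h)$
and $(h,k)$. The factor $1$ or $2$ in $Y_j$ only helps. -/
theorem abs_lag_le_sparsityPenalty {S : ℤ → Matrix (Fin m) (Fin m) ℝ} (hS : IsLagSequence S)
    {j : ℤ} (hj : j ∈ Finset.Icc (-(n : ℤ)) (n : ℤ)) {a b : Fin m} (hab : a ≠ b) :
    |S j a b| ≤ sparsityPenalty n (symbol n S) := by
  have hone : ∀ (i : Fin (n + 1)) (x y : Fin m),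
      |S ((i : ℕ) : ℤ) x y| ≤ ‖oneSided (symbol n S) (i : ℕ) x y‖ := by
    intro i x y
    have hmem : (((i : ℕ) : ℤ)) ∈ Finset.Icc (-(n : ℤ)) (n : ℤ) := by
      have := i.2
      rw [Finset.mem_Icc]
      omega
    rw [oneSided, Matrix.smul_apply, lagCoeff_symbol_apply, if_pos hmem, smul_eq_mul, norm_mul,
      Complex.norm_real, Real.norm_eq_abs]
    refine le_mul_of_one_le_left (abs_nonneg _) ?_
    split_ifs <;> simp
  have hnat : ∀ (i : Fin (n + 1)) (x y : Fin m), x ≠ y →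
      |S ((i : ℕ) : ℤ) x y| ≤ sparsityPenalty n (symbol n S) := by
    intro i x y hxy
    refine (hone i x y).trans ?_
    rcases lt_or_gt_of_ne hxy with h | h
    · exact (le_max_right _ _).trans (max_norm_oneSided_le_sparsityPenalty _ h i)
    · exact (le_max_left _ _).trans (max_norm_oneSided_le_sparsityPenalty _ h i)
  rw [Finset.mem_Icc] at hj
  rcases le_total 0 j with h0 | h0
  · obtain ⟨i, rfl⟩ := Int.eq_ofNat_of_zero_le h0
    exact hnat ⟨i, by omega⟩ a b hab
  · obtain ⟨i, hi⟩ := Int.eq_ofNat_of_zero_le (show 0 ≤ -j by omega)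
    have h1 : S j a b = S (i : ℤ) b a := by
      rw [show j = -(i : ℤ) by omega, hS]
      rfl
    rw [h1]
    exact hnat ⟨i, by omega⟩ b a hab.symm

theorem sparsityPenalty_eq_zero {F : CircleFn m} (hF : ∀ θ a b, a ≠ b → F θ a b = 0) :
    sparsityPenalty n F = 0 := by
  have h0 : ∀ (j : ℕ) (a b : Fin m), a ≠ b → oneSided F j a b = 0 := by
    intro j a b hab
    simp [oneSided, lagCoeff, cmean, hF _ a b hab]
  refine Finset.sum_eq_zero fun k _ => Finset.sum_eq_zero fun h _ => ?_
  split_ifs with hkh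
  · simp [h0 _ k h hkh.ne', h0 _ h k hkh.ne]
  · rfl

/-! ### Comparison with the diagonal part -/

/-- The coefficients of the diagonal part. -/
def diagLag (S : ℤ → Matrix (Fin m) (Fin m) ℝ) : ℤ → Matrix (Fin m) (Fin m) ℝ :=
  fun j => Matrix.diagonal fun a => S j a a

theorem isLagSequence_diagLag {S : ℤ → Matrix (Fin m) (Fin m) ℝ} (hS : IsLagSequence S) :
    IsLagSequence (diagLag S) := fun j => by
  simp [diagLag, hS j]

theorem symbol_diagLag (S : ℤ → Matrix (Fin m) (Fin m) ℝ) (θ : ℝ) :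
    symbol n (diagLag S) θ = Matrix.diagonal fun a => symbol n S θ a a := by
  ext a b
  by_cases hab : a = b
  · subst hab
    simp [symbol_apply, diagLag]
  · simp [symbol_apply, diagLag, hab]

theorem abs_lagPairing_le {T R : ℤ → Matrix (Fin m) (Fin m) ℝ} {M : ℝ}
    (hT : ∀ j ∈ Finset.Icc (-(n : ℤ)) (n : ℤ), ∀ a b, |T j a b| ≤ M) :
    |lagPairing n T R| ≤
      M * ∑ j ∈ Finset.Icc (-(n : ℤ)) (n : ℤ), ∑ a, ∑ b, |R j a b| := by
  unfold lagPairing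
  simp only [Finset.mul_sum]
  refine (Finset.abs_sum_le_sum_abs _ _).trans (Finset.sum_le_sum fun j hj => ?_)
  refine (Finset.abs_sum_le_sum_abs _ _).trans (Finset.sum_le_sum fun a _ => ?_)
  refine (Finset.abs_sum_le_sum_abs _ _).trans (Finset.sum_le_sum fun b _ => ?_)
  rw [abs_mul]
  exact mul_le_mul_of_nonneg_right (hT j hj a b) (abs_nonneg _)

/-- Replacing a feasible pair `(Σ, Λ)` by the diagonal part of `Σ` and `0` increases the entropy
cost by at most a multiple of the penalties. -/
theorem entropyCost_diagLag_le (R : ℤ → Matrix (Fin m) (Fin m) ℝ)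
    {S L : ℤ → Matrix (Fin m) (Fin m) ℝ} (hS : IsLagSequence S)
    (hSL : PosDefOn (symbol n (S - L))) (hL : PosSemidefOn (symbol n L)) :
    PosDefOn (symbol n (diagLag S)) ∧
    entropyCost (symbol n R) (symbol n (diagLag S)) ≤ entropyCost (symbol n R) (symbol n (S - L)) +
      (sparsityPenalty n (symbol n S) + (L 0).trace) *
        ∑ j ∈ Finset.Icc (-(n : ℤ)) (n : ℤ), ∑ a, ∑ b, |R j a b| := by
  have hdecomp : ∀ θ, symbol n S θ = symbol n (S - L) θ + symbol n L θ := fun θ => by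
    rw [symbol_sub]
    simp
  have hSpos : ∀ θ, (symbol n S θ).PosDef := fun θ => by
    rw [hdecomp]
    exact (hSL θ).add_posSemidef (hL θ)
  have hD : PosDefOn (symbol n (diagLag S)) := fun θ => by
    rw [symbol_diagLag]
    exact Matrix.PosDef.diagonal fun a => (hSpos θ).diag_pos
  refine ⟨hD, ?_⟩
  -- Hadamard's inequality at each angle; the diagonal of $\Sigma-\Lambda$ lies below that of
  -- $\Sigma$ because $\Lambda\succeq0$.
  have hlog : mean (fun θ => Real.log (symbol n (S - L) θ).det.re) ≤
      mean fun θ => Real.log (symbol n (diagLag S) θ).det.re := by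
    refine mean_mono (continuous_log_det_symbol hSL) (continuous_log_det_symbol hD) fun θ => ?_
    have hpos : ∀ a, 0 < (symbol n S θ a a).re ∧ (0 : ℝ) = (symbol n S θ a a).im := fun a =>
      Complex.pos_iff.mp (hSpos θ).diag_pos
    have hdet : (symbol n (diagLag S) θ).det.re = ∏ a, (symbol n S θ a a).re := by
      rw [symbol_diagLag, Matrix.det_diagonal]
      have : ∀ a, symbol n S θ a a = (((symbol n S θ a a).re : ℝ) : ℂ) := fun a =>
        Complex.ext rfl (by simp [← (hpos a).2])
      rw [Finset.prod_congr rfl fun a _ => this a, ← Complex.ofReal_prod, Complex.ofReal_re]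
    rw [hdet, Real.log_prod fun a _ => (hpos a).1.ne']
    refine log_det_re_le_sum_log (hSL θ) fun k => ?_
    rw [hdecomp, Matrix.add_apply, Complex.add_re]
    linarith [(Complex.nonneg_iff.mp ((hL θ).diag_nonneg (i := k))).1]
  -- The change of argument is $\Lambda$ minus the off-diagonal part of $\Sigma$; the trace bounds
  -- the coefficients of the former, $\phi_1$ those of the latter.
  have hpair := abs_lagPairing_le (n := n) (T := diagLag S - (S - L)) (R := R)
    (M := sparsityPenalty n (symbol n S) + (L 0).trace) (fun j hj a b => by
      have h1 := abs_lag_le_trace hL hj a b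
      have h2 : |diagLag S j a b - S j a b| ≤ sparsityPenalty n (symbol n S) := by
        by_cases hab : a = b
        · subst hab
          simpa [diagLag] using sparsityPenalty_nonneg _
        · simpa [diagLag, hab] using abs_lag_le_sparsityPenalty hS hj hab
      have h3 : (diagLag S - (S - L)) j a b = (diagLag S j a b - S j a b) + L j a b := by
        simp
        ring
      rw [h3]
      exact (abs_add_le _ _).trans (add_le_add h2 h1))
  rw [lagPairing_sub] at hpair
  rw [entropyCost_symbol hD, entropyCost_symbol hSL]
  linarith [le_of_abs_le hpair]

/-- $(\Delta G^T)(\Delta G^T)^*=0$ gives $\Delta G^T=0$ at every angle, and the entries of $\Delta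
G^T$ are trigonometric polynomials whose coefficients are the entries of $G$. -/
theorem eq_zero_of_shiftQuad_transpose_mul_self_eq_zero {l : ℕ}
    {G : Matrix (Fin l) (Fin (n + 1) × Fin m) ℝ} (h : shiftQuad (Gᵀ * G) = 0) : G = 0 := by
  have hmul : ∀ θ, shift m n θ * (G.map Complex.ofReal)ᵀ = 0 := by
    intro θ
    refine Matrix.self_mul_conjTranspose_eq_zero.mp ?_
    have h1 : (Gᵀ * G).map Complex.ofReal =
        (G.map Complex.ofReal)ᵀ * ((G.map Complex.ofReal)ᵀ)ᴴ := by
      ext p q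
      simp [Matrix.mul_apply]
    have h2 := congrFun h θ
    rw [shiftQuad, h1] at h2
    rw [Matrix.conjTranspose_mul, Matrix.mul_assoc]
    rw [Matrix.mul_assoc, Matrix.mul_assoc] at h2
    exact h2
  ext i q
  obtain ⟨k, a⟩ := q
  have hentry : ∀ θ : ℝ, ∑ k' : Fin (n + 1),
      Complex.exp (Complex.I * (((k' : ℕ) : ℤ) : ℂ) * (θ : ℂ)) *
        (Complex.exp (-(Complex.I * (((k : ℕ) : ℤ) : ℂ) * (θ : ℂ))) * (G i (k', a) : ℂ)) = 0 := by
    intro θ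
    have h1 := congrFun (congrFun (hmul θ) a) i
    simp only [Matrix.mul_apply, shift, Matrix.of_apply, Matrix.transpose_apply, Matrix.map_apply,
      Fintype.sum_prod_type, ite_mul, zero_mul, Finset.sum_ite_eq, Finset.mem_univ, if_true,
      Matrix.zero_apply] at h1
    have h2 := congrArg
      (fun z => Complex.exp (-(Complex.I * (((k : ℕ) : ℤ) : ℂ) * (θ : ℂ))) * z) h1
    simp only [mul_zero, Finset.mul_sum] at h2
    rw [← h2]
    refine Finset.sum_congr rfl fun k' _ => ?_
    push_cast
    ring
  have h0 : cmean (fun θ : ℝ => ∑ k' : Fin (n + 1),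
      Complex.exp (Complex.I * (((k' : ℕ) : ℤ) : ℂ) * (θ : ℂ)) *
        (Complex.exp (-(Complex.I * (((k : ℕ) : ℤ) : ℂ) * (θ : ℂ))) * (G i (k', a) : ℂ))) = 0 := by
    simp only [hentry]
    simp [cmean]
  rw [cmean_sum _ fun k' _ => by fun_prop] at h0
  simp only [cmean_exp_mul_exp] at h0
  rw [Finset.sum_eq_single k] at h0
  · simpa using h0
  · intro k' _ hk'
    rw [if_neg]
    exact fun h => hk' (Fin.ext (by exact_mod_cast h))
  · simp

/-- With $c=\sum|R_j|$, comparison with $(\operatorname{diag}\Sigma,0)$ yields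
$(\lambda\gamma-c)\,\phi_1(\Sigma)+(\lambda-c)\operatorname{tr}L_0\le0$. Strictness is needed only
in the second factor, where it forces $\operatorname{tr}L_0\le0$ and so annihilates all coefficients
of $\Lambda$. -/
theorem low_rank_part_eq_zero {R S L : ℤ → Matrix (Fin m) (Fin m) ℝ} (hS : IsLagSequence S)
    {lam gam : ℝ}
    (hc₁ : ∑ j ∈ Finset.Icc (-(n : ℤ)) (n : ℤ), ∑ a, ∑ b, |R j a b| ≤ lam * gam)
    (hc₂ : ∑ j ∈ Finset.Icc (-(n : ℤ)) (n : ℤ), ∑ a, ∑ b, |R j a b| < lam)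
    (hsol : IsRegSolution n R lam gam (symbol n S, symbol n L)) : symbol n L = 0 := by
  obtain ⟨⟨-, -, hSL, hL⟩, hmin⟩ := hsol
  simp only [← symbol_sub] at hSL
  obtain ⟨hD, hle⟩ := entropyCost_diagLag_le R hS hSL hL
  have hfeas : (symbol n (diagLag S), (0 : CircleFn m)) ∈ regFeasible m n :=
    ⟨⟨_, isLagSequence_diagLag hS, rfl⟩, zero_mem_pseudoPoly, by simpa using hD,
      fun _ => Matrix.PosSemidef.zero⟩
  have h := hmin hfeas
  have hsp : sparsityPenalty n (symbol n (diagLag S)) = 0 := sparsityPenalty_eq_zero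
    fun θ a b hab => by rw [symbol_diagLag, Matrix.diagonal_apply_ne _ hab]
  have hlr : lowRankPenalty (0 : CircleFn m) = 0 := by
    rw [lowRankPenalty_of_posSemidefOn (F := 0) fun _ => Matrix.PosSemidef.zero]
    simp [mean]
  simp only [Set.mem_ofPred_eq, regCost, sub_zero, hsp, hlr, mul_zero, add_zero,
    lowRankPenalty_symbol hL, ← symbol_sub] at h
  have hφ := sparsityPenalty_nonneg (n := n) (symbol n S)
  have htr0 : (L 0).trace ≤ 0 := by
    by_contra! hpos
    nlinarith [mul_lt_mul_of_pos_right hc₂ hpos, mul_le_mul_of_nonneg_right hc₁ hφ]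
  rw [symbol_congr (T := 0) fun j hj => ?_, symbol_zero]
  ext a b
  exact abs_nonpos_iff.mp ((abs_lag_le_trace hL hj a b).trans htr0)

end ARLatent

/-! ### The corollary -/

theorem mainTheorem7 (m n : ℕ) (R : ℤ → Matrix (Fin m) (Fin m) ℝ)
    (hR : ARLatent.IsLagSequence R) (hpos : (ARLatent.blockToeplitz n R).PosDef) :
    (∃ c₁ c₂ : ℝ, ∀ lam gam : ℝ, 0 < lam → 0 < gam → c₁ ≤ lam * gam → c₂ ≤ lam →
      ∀ (l : ℕ) (E : Set (Fin m × Fin m)) (G : Matrix (Fin l) (Fin (n + 1) × Fin m) ℝ),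
        ARLatent.IsEstimate R lam gam E G →
          ARLatent.sparseSpace n E ∩ ARLatent.lowRankSpace G = {0} ∧
          ARLatent.HasUniqueModel R E G) ∧
    (∀ lam gam : ℝ, 0 < lam → 0 < gam →
      ∀ (l : ℕ) (E : Set (Fin m × Fin m)) (G : Matrix (Fin l) (Fin (n + 1) × Fin m) ℝ),
        ARLatent.IsEstimate R lam gam E G →
        ARLatent.sparseSpace n E ∩ ARLatent.lowRankSpace G = {0} →
          ARLatent.HasUniqueModel R E G) := by
  -- The summand $1$ in $c_2$ stands outside the triple sum and turns $c_2\le\lambda$ into the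
  -- strict inequality needed to kill $\Lambda$.
  refine ⟨⟨∑ j ∈ Finset.Icc (-(n : ℤ)) (n : ℤ), ∑ a, ∑ b, |R j a b|,
    ∑ j ∈ Finset.Icc (-(n : ℤ)) (n : ℤ), ∑ a, ∑ b, |R j a b| + 1, ?_⟩, ?_⟩
  · intro lam gam _ _ hc₁ hc₂ l E G hest
    have hinter : ARLatent.sparseSpace n E ∩ ARLatent.lowRankSpace G = {0} := by
      obtain ⟨S, L, hsol, -, hrank, hL⟩ := id hest
      obtain ⟨s, hs, rfl⟩ := id hsol.1.1
      obtain ⟨r, -, rfl⟩ := id hsol.1.2.1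
      have hzero := ARLatent.low_rank_part_eq_zero hs hc₁ (by linarith) hsol
      have hG := ARLatent.eq_zero_of_shiftQuad_transpose_mul_self_eq_zero (hL.symm.trans hzero)
      subst hG
      refine Set.Subset.antisymm ?_ (Set.singleton_subset_iff.mpr
        ⟨ARLatent.zero_mem_sparseSpace E, ARLatent.zero_mem_lowRankSpace _⟩)
      rintro F ⟨-, H, -, rfl⟩
      rw [Matrix.mul_zero, ARLatent.shiftQuad_zero]
      exact Set.mem_singleton _
    exact ⟨hinter, ARLatent.hasUniqueModel_of_inter_eq hR hpos
      (ARLatent.diag_mem_of_isEstimate hest) hinter⟩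
  · intro lam gam _ _ l E G hest hinter
    exact ARLatent.hasUniqueModel_of_inter_eq hR hpos (ARLatent.diag_mem_of_isEstimate hest) hinter
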